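/- Let $D\subset\mathbb{C}^n$ be a bounded domain (a nonempty, connected, bounded open set). For $p\in D$ let $$s_D(p)=\sup_f\,\sup\{r : B^n(0,r)\subset f(D)\},$$ where $f$ runs over all (open) holomorphic embeddings $f:D\to B^n$ into the unit ball of $\mathbb{C}^n$ with $f(p)=0$, and $B^n(0,r)$ is the ball with center $0$ and radius $r$. Suppose that $D$ is holomorphic homogeneous regular, i.e. that there is a constant $c>0$ with $s_D(p)\ge c$ for all $p\in D$. Then the Kobayashi metric and the Bergman metric on $D$ are complete. That is, each of the following two functions is a (finite, nondegenerate) distance on $D$ for which $D$ is a complete metric space: (1) the Kobayashi distance $K_D(x,y)$, the infimum of the sums $\sum_{i=1}^k\rho(a_i,b_i)$ over all finite chains of holomorphic maps $f_1,\dots,f_k:\Delta\to D$ from the unit disc $\Delta$ and points $a_i,b_i\in\Delta$ with $f_1(a_1)=x$, $f_i(b_i)=f_{i+1}(a_{i+1})$ for $1\le i<k$, and $f_k(b_k)=y$ (the empty chain, of length $0$, being allowed when $x=y$), where $\rho(a,b)=\log\frac{1+\delta}{1-\delta}$ with $\delta=\left|\frac{a-b}{1-\bar a b}\right|$; (2)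 the Bergman distance, the infimum of the lengths of $C^1$ curves in $D$ from $x$ to $y$ with respect to the Hermitian metric $\sum_{j,k}\frac{\partial^2\log K(z,z)}{\partial z_j\,\partial\bar z_k}\,dz_j\,d\bar z_k$, where $K$ is the Bergman kernel of $D$, i.e. the reproducing kernel of the Hilbert space of holomorphic functions on $D$ that are square integrable for Lebesgue measure. -/

import Mathlib

noncomputable section

namespace HHR

open Set MeasureTheory
open scoped ENNReal NNReal ContDiff

/-- Complex Euclidean space `ℂⁿ` with its Hermitian norm. -/
abbrev Cn (n : ℕ) : Type := EuclideanSpace ℂ (Fin n)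

/-- A bounded domain: a nonempty, connected, bounded open set. -/
structure IsBoundedDomain {n : ℕ} (D : Set (Cn n)) : Prop where
  isOpen : IsOpen D
  isConnected : IsConnected D
  isBounded : Bornology.IsBounded D

/-! ### Squeezing functions -/

/-- `f` is an (open) holomorphic embedding of `D` into the unit ball with `f p = 0`. -/
structure IsBallEmbedding {n : ℕ} (D : Set (Cn n)) (p : Cn n) (f : Cn n → Cn n) : Prop where
  differentiableOn : DifferentiableOn ℂ f D
  isOpenEmbedding : Topology.IsOpenEmbedding (D.domRestrict f)
  mapsTo : MapsTo f D (Metric.ball 0 1)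
  map_base : f p = 0

/-- `s_D(p, f) = sup {r | B(0, r) ⊆ f(D)}`. -/
def squeezingNumber {n : ℕ} (D : Set (Cn n)) (f : Cn n → Cn n) : ℝ≥0∞ :=
  ⨆ (r : ℝ≥0) (_ : Metric.ball (0 : Cn n) r ⊆ f '' D), (r : ℝ≥0∞)

/-- The squeezing function `s_D(p) = sup_f s_D(p, f)`, where `f` runs over the holomorphic
embeddings of `D` into the unit ball with `f p = 0`. -/
def squeezingFunction {n : ℕ} (D : Set (Cn n)) (p : Cn n) : ℝ≥0∞ :=
  ⨆ (f : Cn n → Cn n) (_ : IsBallEmbedding D p f), squeezingNumber D f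

/-- A holomorphic homogeneous regular domain: a bounded domain whose squeezing function has a
positive lower bound. -/
structure IsHolomorphicHomogeneousRegular {n : ℕ} (D : Set (Cn n)) : Prop
    extends IsBoundedDomain D where
  exists_lower_bound : ∃ c : ℝ≥0∞, 0 < c ∧ ∀ p ∈ D, c ≤ squeezingFunction D p

/-! ### The Kobayashi distance -/

/-- The Poincaré distance of the unit disc, `log ((1 + δ) / (1 - δ))` with
`δ = |a - b| / |1 - conj a * b|`. -/
def poincareDist (a b : ℂ) : ℝ :=
  Real.log ((1 + ‖(a - b) / (1 - (starRingEnd ℂ) a * b)‖) /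
    (1 - ‖(a - b) / (1 - (starRingEnd ℂ) a * b)‖))

/-- A chain of holomorphic discs in `D` from `x` to `y`: points `x = p₀, …, p_k = y`, holomorphic
maps `f₁, …, f_k` from the unit disc to `D`, and points `a_i`, `b_i` of the unit disc such that
`f_i(a_i) = p_{i-1}` and `f_i(b_i) = p_i` (the index `i` is shifted by one below). -/
structure DiscChain {n : ℕ} (D : Set (Cn n)) (x y : Cn n) where
  /-- the number of discs -/
  k : ℕ
  /-- the intermediate points -/
  p : Fin (k + 1) → Cn n
  /-- the discs -/
  f : Fin k → ℂ → Cn n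
  /-- the starting parameters -/
  a : Fin k → ℂ
  /-- the end parameters -/
  b : Fin k → ℂ
  start_eq : p 0 = x
  end_eq : p (Fin.last k) = y
  a_mem : ∀ i, a i ∈ Metric.ball (0 : ℂ) 1
  b_mem : ∀ i, b i ∈ Metric.ball (0 : ℂ) 1
  differentiableOn : ∀ i, DifferentiableOn ℂ (f i) (Metric.ball 0 1)
  mapsTo : ∀ i, MapsTo (f i) (Metric.ball 0 1) D
  map_a : ∀ i, f i (a i) = p i.castSucc
  map_b : ∀ i, f i (b i) = p i.succ

/-- The Poincaré length of a chain of discs. -/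
def DiscChain.length {n : ℕ} {D : Set (Cn n)} {x y : Cn n} (c : DiscChain D x y) : ℝ :=
  ∑ i, poincareDist (c.a i) (c.b i)

/-- The Kobayashi (pseudo-)distance of `D`, the infimum of the lengths of the chains of
holomorphic discs from `x` to `y`. -/
def kobayashiDist {n : ℕ} (D : Set (Cn n)) (x y : Cn n) : ℝ≥0∞ :=
  ⨅ c : DiscChain D x y, ENNReal.ofReal c.length

/-! ### The Bergman distance -/

/-- The Bergman space of square integrable holomorphic functions on `D`. -/
def bergmanSpace {n : ℕ} (D : Set (Cn n)) : Set (Cn n → ℂ) :=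
  {f | DifferentiableOn ℂ f D ∧ MemLp f 2 (volume.restrict D)}

/-- `k` represents the evaluation at `w` on the Bergman space, i.e. `k = K_D(·, w)` on `D`. -/
structure IsReproducingAt {n : ℕ} (D : Set (Cn n)) (w : Cn n) (k : Cn n → ℂ) : Prop where
  mem : k ∈ bergmanSpace D
  reproducing : ∀ f ∈ bergmanSpace D, f w = ∫ z in D, f z * (starRingEnd ℂ) (k z)

open scoped Classical in
/-- The Bergman kernel `K_D(z, w)`: for `w ∈ D`, the function `K_D(·, w)` is the (unique) element
of the Bergman space that represents the evaluation at `w`. -/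
def bergmanKernel {n : ℕ} (D : Set (Cn n)) (z w : Cn n) : ℂ :=
  if h : ∃ k, IsReproducingAt D w k then h.choose z else 0

/-- The Wirtinger derivative `∂φ/∂z_j = (∂φ/∂x_j - i ∂φ/∂y_j) / 2`. -/
def wirtinger {n : ℕ} (j : Fin n) (φ : Cn n → ℂ) (z : Cn n) : ℂ :=
  (fderiv ℝ φ z (EuclideanSpace.single j 1) -
    Complex.I * fderiv ℝ φ z (EuclideanSpace.single j Complex.I)) / 2

/-- The conjugate Wirtinger derivative `∂φ/∂z̄_j = (∂φ/∂x_j + i ∂φ/∂y_j) / 2`. -/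
def wirtingerBar {n : ℕ} (j : Fin n) (φ : Cn n → ℂ) (z : Cn n) : ℂ :=
  (fderiv ℝ φ z (EuclideanSpace.single j 1) +
    Complex.I * fderiv ℝ φ z (EuclideanSpace.single j Complex.I)) / 2

/-- The coefficients `g_{jk}(z) = ∂² log K_D(z, z) / ∂z_j ∂z̄_k` of the Bergman metric. -/
def bergmanCoeff {n : ℕ} (D : Set (Cn n)) (j k : Fin n) (z : Cn n) : ℂ :=
  wirtinger j (wirtingerBar k fun ζ => ((Real.log (bergmanKernel D ζ ζ).re : ℝ) : ℂ)) z

/-- The Bergman norm `(∑ g_{jk}(z) v_j v̄_k)^{1/2}` of a tangent vector `v` at `z`. -/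
def bergmanNorm {n : ℕ} (D : Set (Cn n)) (z v : Cn n) : ℝ :=
  √(∑ j, ∑ k, bergmanCoeff D j k z * v j * (starRingEnd ℂ) (v k)).re

/-- `γ : [0, 1] → D` is a `C¹` curve from `x` to `y`. -/
structure IsCurveIn {n : ℕ} (D : Set (Cn n)) (x y : Cn n) (γ : ℝ → Cn n) : Prop where
  contDiffOn : ContDiffOn ℝ 1 γ (Icc 0 1)
  mapsTo : MapsTo γ (Icc 0 1) D
  start_eq : γ 0 = x
  end_eq : γ 1 = y

/-- The length of a curve `γ : [0, 1] → D` in the Bergman metric. -/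
def bergmanLength {n : ℕ} (D : Set (Cn n)) (γ : ℝ → Cn n) : ℝ≥0∞ :=
  ∫⁻ t in Icc (0 : ℝ) 1, ENNReal.ofReal (bergmanNorm D (γ t) (derivWithin γ (Icc 0 1) t))

/-- The Bergman distance of `D`: the infimum of the Bergman lengths of the `C¹` curves in `D`
from `x` to `y`. -/
def bergmanDist {n : ℕ} (D : Set (Cn n)) (x y : Cn n) : ℝ≥0∞ :=
  ⨅ (γ : ℝ → Cn n) (_ : IsCurveIn D x y γ), bergmanLength D γ

/-! ### Completeness -/

/-- `d` is a (finite, nondegenerate) metric on `D`, and `D` is complete with respect to `d`. -/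
def IsCompleteMetricOn {n : ℕ} (D : Set (Cn n)) (d : Cn n → Cn n → ℝ≥0∞) : Prop :=
  ∃ m : MetricSpace D,
    (∀ x y : D, m.edist x y = d x y) ∧
      @CompleteSpace D m.toPseudoMetricSpace.toUniformSpace

end HHR

end

noncomputable section

namespace HHR

open Set MeasureTheory Filter Topology
open scoped ENNReal NNReal ContDiff

/-! ### A completeness criterion -/

/-! The squeezing hypothesis gives a radius $c>0$ such that every $p\in D$ has a holomorphic map
$f:D\to B^n$ with $f(p)=0$ for which $f^{-1}(\overline{B}(0,c))$ is a compact subset of $D$. If a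
distance $d$ satisfies $\|f(x)-f(y)\|\le 2d(x,y)$ for all holomorphic $f:D\to B^n$, then every
$d$-ball of radius $c/2$ lies in such a compact set. As the radius does not depend on the centre, a
Cauchy sequence eventually stays in one of these compact sets and converges there, provided
Euclidean convergence inside $D$ implies $d$-convergence.
`IsHolomorphicHomogeneousRegular.isCompleteMetricOn` isolates this argument; the rest verifies its
hypotheses for the two distances.

For the Kobayashi distance the Lipschitz bound is the Schwarz lemma applied to each disc of a chain
(`norm_sub_le_poincareDist`), and the local upper bound comes from affine discs.

For the Bergman distance, let $k_z$ represent evaluation at $z$. The Levi form of $\log\|k_z\|^2$ at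
$v$ is $\|k_z\|^{-2}$ times the squared norm of the part of $\partial_v k_z$ orthogonal to $k_z$
(`levi_log_norm_sq`). Testing against $F=(\varphi-\varphi(z))k_z$, which vanishes at $z$, gives
$|d\varphi_z(v)|\le 2\cdot$(Bergman norm of $v$) whenever $|\varphi|\le 1$
(`norm_fderiv_le_bergmanNorm`). Integrating along curves yields the Lipschitz bound; local
boundedness of the Bergman norm gives the upper bound. -/

theorem completeSpace_of_forall_dist_lt {Y : Type*} [MetricSpace Y] {ε : ℝ} (hε : 0 < ε)
    (h : ∀ (x : Y) (u : ℕ → Y), (∀ n, dist x (u n) < ε) →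
      ∃ (a : Y) (φ : ℕ → ℕ), StrictMono φ ∧ Tendsto (fun n => dist a (u (φ n))) atTop (𝓝 0)) :
    CompleteSpace Y := by
  refine Metric.complete_of_cauchySeq_tendsto fun u hu => ?_
  obtain ⟨N, hN⟩ := Metric.cauchySeq_iff'.1 hu ε hε
  obtain ⟨a, φ, hφ, hlim⟩ := h (u N) (fun n => u (n + N)) fun n => by
    rw [dist_comm]; exact hN _ (by omega)
  refine ⟨a, tendsto_nhds_of_cauchySeq_of_subseq hu
    (f := fun n => φ n + N) (p := atTop)
    (tendsto_atTop_mono (fun n => Nat.le_add_right _ _) hφ.tendsto_atTop) ?_⟩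
  rw [tendsto_iff_dist_tendsto_zero]
  simpa only [dist_comm, Function.comp_def] using hlim

/-- The only consequence of the squeezing bound needed later: the radius is independent of `p`.
Injectivity and openness of the embeddings survive only as compactness of a preimage. -/
theorem IsHolomorphicHomogeneousRegular.exists_uniform_compact {n : ℕ} {D : Set (Cn n)}
    (hD : IsHolomorphicHomogeneousRegular D) :
    ∃ c : ℝ, 0 < c ∧ ∀ p ∈ D, ∃ f : Cn n → Cn n, DifferentiableOn ℂ f D ∧
      MapsTo f D (Metric.ball 0 1) ∧ f p = 0 ∧
      IsCompact (D.domRestrict f ⁻¹' Metric.closedBall 0 c) := by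
  obtain ⟨c, hc, hcD⟩ := hD.exists_lower_bound
  obtain ⟨c', hc'0, hc'⟩ := ENNReal.lt_iff_exists_nnreal_btwn.1 hc
  refine ⟨c', by simpa using hc'0, fun p hp => ?_⟩
  have h1 := hc'.trans_le (hcD p hp)
  unfold squeezingFunction at h1
  simp only [lt_iSup_iff] at h1
  obtain ⟨f, hf, h2⟩ := h1
  unfold squeezingNumber at h2
  simp only [lt_iSup_iff] at h2
  obtain ⟨r, hr, h3⟩ := h2
  refine ⟨f, hf.differentiableOn, hf.mapsTo, hf.map_base, ?_⟩
  -- Since `c' < r`, the closed ball of radius `c'` lies inside the image, where the embedding has a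
  -- continuous inverse.
  refine hf.isOpenEmbedding.isInducing.isCompact_preimage' (isCompact_closedBall _ _) ?_
  rw [Set.range_domRestrict]
  exact (Metric.closedBall_subset_ball (by exact_mod_cast h3)).trans hr

/-- A distance function on a holomorphic homogeneous regular domain which is locally controlled by
the Euclidean distance and for which holomorphic maps to the unit ball are uniformly Lipschitz is
a complete metric. -/
theorem IsHolomorphicHomogeneousRegular.isCompleteMetricOn {n : ℕ} {D : Set (Cn n)}
    (hD : IsHolomorphicHomogeneousRegular D) (d : Cn n → Cn n → ℝ≥0∞)
    (hself : ∀ x ∈ D, d x x = 0) (hsymm : ∀ x ∈ D, ∀ y ∈ D, d x y ≤ d y x)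
    (htri : ∀ x ∈ D, ∀ y ∈ D, ∀ z ∈ D, d x z ≤ d x y + d y z)
    (hup : ∀ x ∈ D, ∀ ε : ℝ≥0∞, 0 < ε → ∀ᶠ y in 𝓝 x, d x y < ε)
    (hlow : ∀ f : Cn n → Cn n, DifferentiableOn ℂ f D → MapsTo f D (Metric.ball 0 1) →
      ∀ x ∈ D, ∀ y ∈ D, ENNReal.ofReal ‖f x - f y‖ ≤ 2 * d x y) :
    IsCompleteMetricOn D d := by
  have hsymm' : ∀ x ∈ D, ∀ y ∈ D, d x y = d y x := fun x hx y hy =>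
    le_antisymm (hsymm x hx y hy) (hsymm y hy x hx)
  have hfin : ∀ x ∈ D, ∀ y ∈ D, d x y ≠ ⊤ := by
    intro x hx
    -- The points at finite distance from `x` form an open and relatively closed subset of the
    -- connected set `D`.
    have hpre : D ⊆ {y | d x y < ⊤} := by
      have hsub := hD.isConnected.isPreconnected.subset_of_closure_inter_subset
        (u := {y | y ∈ D ∧ d x y < ⊤}) ?_ ⟨x, hx, hx, by simp [hself x hx]⟩ ?_
      · exact fun y hy => (hsub hy).2
      · rw [isOpen_iff_mem_nhds]
        rintro y ⟨hy, hy'⟩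
        filter_upwards [hup y hy 1 one_pos, hD.isOpen.mem_nhds hy] with z hz hzD
        exact ⟨hzD, (htri x hx y hy z hzD).trans_lt
          (ENNReal.add_lt_top.2 ⟨hy', hz.trans ENNReal.one_lt_top⟩)⟩
      · rintro y ⟨hy, hyD⟩
        obtain ⟨z, hz1, hz2, hz3⟩ := mem_closure_iff_nhds.1 hy _ (hup y hyD 1 one_pos)
        exact ⟨hyD, (htri x hx z hz2 y hyD).trans_lt (ENNReal.add_lt_top.2
          ⟨hz3, by rw [hsymm' z hz2 y hyD]; exact lt_trans hz1 ENNReal.one_lt_top⟩)⟩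
    exact fun y hy => (hpre hy).ne
  have heq : ∀ x ∈ D, ∀ y ∈ D, d x y = 0 → x = y := by
    intro x hx y hy hxy
    obtain ⟨R, hR0, hR⟩ := hD.isBounded.subset_ball_lt 0 0
    -- Because `D` is bounded, a rescaled identity is an admissible map, and it separates points.
    have h := hlow (fun z => ((R⁻¹ : ℝ) : ℂ) • z) (by fun_prop) (fun z hz => by
      have := hR hz
      rw [mem_ball_zero_iff] at this ⊢
      rw [norm_smul, Complex.norm_real, Real.norm_of_nonneg (by positivity), inv_mul_lt_one₀ hR0]
      exact this) x hx y hy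
    rw [hxy, mul_zero, nonpos_iff_eq_zero, ENNReal.ofReal_eq_zero, ← smul_sub, norm_smul] at h
    have h3 : ‖x - y‖ = 0 := by
      rcases mul_eq_zero.1 (le_antisymm h (by positivity)) with h | h
      · simp [hR0.ne'] at h
      · exact h
    exact sub_eq_zero.1 (norm_eq_zero.1 h3)
  let m0 : EMetricSpace D :=
    { edist := fun x y => d x y
      edist_self := fun x => hself x x.2
      edist_comm := fun x y => hsymm' x x.2 y y.2
      edist_triangle := fun x y z => htri x x.2 y y.2 z z.2
      eq_of_edist_eq_zero := fun {x y} h => Subtype.ext (heq x x.2 y y.2 h) }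
  let m : MetricSpace D := @EMetricSpace.toMetricSpace D m0 fun x y => hfin x x.2 y y.2
  have hm : ∀ x y : D, m.dist x y = (d x y).toReal := fun x y => rfl
  refine ⟨m, fun x y => rfl, ?_⟩
  obtain ⟨c, hc, hcD⟩ := hD.exists_uniform_compact
  -- The factor 2 in `hlow` turns `d`-distance below `c / 2` into `‖f (u k)‖ < c`.
  refine @completeSpace_of_forall_dist_lt D m (c / 2) (by positivity) fun x u hu => ?_
  obtain ⟨f, hf, hfm, hfx, hK⟩ := hcD x x.2
  have hmem : ∀ k, u k ∈ D.domRestrict f ⁻¹' Metric.closedBall 0 c := fun k => by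
    have h1 : (d x (u k)).toReal < c / 2 := hu k
    have h2 := hlow f hf hfm x x.2 (u k) (u k).2
    rw [hfx, zero_sub, norm_neg] at h2
    have h3 := ENNReal.toReal_mono
      (ENNReal.mul_ne_top (by simp) (hfin x x.2 (u k) (u k).2)) h2
    rw [ENNReal.toReal_ofReal (norm_nonneg _), ENNReal.toReal_mul] at h3
    simp only [ENNReal.toReal_ofNat] at h3
    simp only [mem_preimage, Set.domRestrict_apply, mem_closedBall_zero_iff]
    linarith
  obtain ⟨a, -, φ, hφ, hlim⟩ := hK.tendsto_subseq hmem
  refine ⟨a, φ, hφ, ?_⟩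
  have hlim' : Tendsto (fun k => (u (φ k) : Cn n)) atTop (𝓝 (a : Cn n)) :=
    (continuous_subtype_val.tendsto a).comp hlim
  have h0 : Tendsto (fun k => d a (u (φ k))) atTop (𝓝 0) := by
    rw [ENNReal.tendsto_nhds_zero]
    intro ε hε
    exact (hlim'.eventually (hup a a.2 ε hε)).mono fun _ h => h.le
  exact (ENNReal.tendsto_toReal ENNReal.zero_ne_top).comp h0

/-! ### The Kobayashi distance -/

theorem pseudoHyperbolic_lt_one {a b : ℂ} (ha : ‖a‖ < 1) (hb : ‖b‖ < 1) :
    ‖(a - b) / (1 - (starRingEnd ℂ) a * b)‖ < 1 := by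
  have key : ‖1 - (starRingEnd ℂ) a * b‖ ^ 2 - ‖a - b‖ ^ 2 = (1 - ‖a‖ ^ 2) * (1 - ‖b‖ ^ 2) := by
    simp only [← Complex.normSq_eq_norm_sq, Complex.normSq_apply]
    simp
    ring
  have h1 : 0 < (1 - ‖a‖ ^ 2) * (1 - ‖b‖ ^ 2) := by
    apply mul_pos <;> nlinarith [norm_nonneg a, norm_nonneg b]
  have h2 : ‖a - b‖ < ‖1 - (starRingEnd ℂ) a * b‖ :=
    lt_of_pow_lt_pow_left₀ 2 (norm_nonneg _) (by linarith)
  rw [norm_div]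
  exact (div_lt_one ((norm_nonneg _).trans_lt h2)).2 h2

theorem one_sub_conj_mul_ne_zero {a b : ℂ} (ha : ‖a‖ < 1) (hb : ‖b‖ < 1) :
    1 - (starRingEnd ℂ) a * b ≠ 0 := by
  intro h
  have : ‖(starRingEnd ℂ) a * b‖ = 1 := by rw [← sub_eq_zero.1 h]; simp
  rw [norm_mul, RCLike.norm_conj] at this
  nlinarith [norm_nonneg a, norm_nonneg b]

/-- Both terms of $\log(1+\delta)-\log(1-\delta)$ are nonnegative, and the second is already at
least $\delta$. -/
theorem le_poincareDist {a b : ℂ} (ha : ‖a‖ < 1) (hb : ‖b‖ < 1) :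
    ‖(a - b) / (1 - (starRingEnd ℂ) a * b)‖ ≤ poincareDist a b := by
  have h1 := pseudoHyperbolic_lt_one ha hb
  unfold poincareDist
  set δ := ‖(a - b) / (1 - (starRingEnd ℂ) a * b)‖
  have h0 : 0 ≤ δ := norm_nonneg _
  rw [Real.log_div (by positivity) (by linarith)]
  have h2 := Real.log_le_sub_one_of_pos (x := 1 - δ) (by linarith)
  have h3 := Real.log_nonneg (x := 1 + δ) (by linarith)
  linarith

theorem poincareDist_comm (a b : ℂ) : poincareDist a b = poincareDist b a := by
  have : ‖(a - b) / (1 - (starRingEnd ℂ) a * b)‖ = ‖(b - a) / (1 - (starRingEnd ℂ) b * a)‖ := by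
    rw [norm_div, norm_div, norm_sub_rev, ← RCLike.norm_conj (1 - (starRingEnd ℂ) a * b)]
    simp [mul_comm]
  simp only [poincareDist, this]

theorem poincareDist_nonneg {a b : ℂ} (ha : ‖a‖ < 1) (hb : ‖b‖ < 1) : 0 ≤ poincareDist a b :=
  (norm_nonneg _).trans (le_poincareDist ha hb)

/-- Holomorphic maps from the disc to the unit ball are Lipschitz for the Poincaré distance. -/
theorem norm_sub_le_poincareDist {E : Type*} [NormedAddCommGroup E] [NormedSpace ℂ E]
    {g : ℂ → E} (hg : DifferentiableOn ℂ g (Metric.ball 0 1))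
    (hgm : MapsTo g (Metric.ball 0 1) (Metric.ball 0 1)) {a b : ℂ} (ha : ‖a‖ < 1) (hb : ‖b‖ < 1) :
    ‖g a - g b‖ ≤ 2 * poincareDist a b := by
  -- The disc involution exchanging `0` and `a`: it moves `a` to the centre, where the Schwarz lemma
  -- applies, and `‖T b‖` is the pseudo-hyperbolic distance of `a` and `b`.
  let T : ℂ → ℂ := fun z => (a - z) / (1 - (starRingEnd ℂ) a * z)
  have hT : MapsTo T (Metric.ball 0 1) (Metric.ball 0 1) := fun z hz => by
    rw [mem_ball_zero_iff] at hz ⊢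
    exact pseudoHyperbolic_lt_one ha hz
  have hTd : DifferentiableOn ℂ T (Metric.ball 0 1) := fun z hz => by
    rw [mem_ball_zero_iff] at hz
    have := one_sub_conj_mul_ne_zero ha hz
    exact DifferentiableAt.differentiableWithinAt (by fun_prop (disch := assumption))
  have hT0 : T 0 = a := by simp [T]
  have hTT : T (T b) = b := by
    have h1 := one_sub_conj_mul_ne_zero ha hb
    have h2 := one_sub_conj_mul_ne_zero ha ha
    have h3 : T (T b) * (1 - (starRingEnd ℂ) a * T b) = a - T b :=
      div_mul_cancel₀ _ (one_sub_conj_mul_ne_zero ha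
        (mem_ball_zero_iff.1 (hT (mem_ball_zero_iff.2 hb))))
    have h4 : T b * (1 - (starRingEnd ℂ) a * b) = a - b := div_mul_cancel₀ _ h1
    have h5 : 1 - (starRingEnd ℂ) a * T b ≠ 0 := one_sub_conj_mul_ne_zero ha
        (mem_ball_zero_iff.1 (hT (mem_ball_zero_iff.2 hb)))
    apply mul_right_cancel₀ h5
    rw [h3]
    linear_combination (-1 : ℂ) * h4
  have hmem : T b ∈ Metric.ball (0 : ℂ) 1 := hT (mem_ball_zero_iff.2 hb)
  -- The target ball must be centred at `g a`; radius 2 contains the unit ball whatever point of it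
  -- `g a` is.
  have h := Complex.dist_le_div_mul_dist_of_mapsTo_ball (f := g ∘ T) (c := 0) (z := T b)
    (R₁ := 1) (R₂ := 2) (hg.comp hTd hT) (fun z hz => by
      have h1 := mem_ball_zero_iff.1 (hgm (hT hz))
      have h2 := mem_ball_zero_iff.1 (hgm (mem_ball_zero_iff.2 ha))
      rw [Metric.mem_closedBall, dist_eq_norm]
      simp only [Function.comp_apply, hT0]
      exact (norm_sub_le _ _).trans (by linarith)) hmem
  simp only [Function.comp_apply, hT0, hTT, dist_zero_right] at h
  rw [dist_comm, dist_eq_norm] at h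
  have := le_poincareDist ha hb
  change ‖T b‖ ≤ _ at this
  linarith

theorem dist_le_fin_sum_dist {X : Type*} [PseudoMetricSpace X] :
    ∀ (k : ℕ) (p : Fin (k + 1) → X),
      dist (p 0) (p (Fin.last k)) ≤ ∑ i : Fin k, dist (p i.castSucc) (p i.succ)
  | 0, p => by simp
  | k + 1, p => by
    rw [Fin.sum_univ_castSucc]
    refine (dist_triangle _ (p (Fin.last k).castSucc) _).trans ?_
    have := dist_le_fin_sum_dist k fun i => p i.castSucc
    exact add_le_add this (by simp)

namespace DiscChain

variable {n : ℕ} {D : Set (Cn n)} {x y z : Cn n}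

theorem poincareDist_nonneg (c : DiscChain D x y) (i : Fin c.k) :
    0 ≤ poincareDist (c.a i) (c.b i) :=
  HHR.poincareDist_nonneg (mem_ball_zero_iff.1 (c.a_mem i)) (mem_ball_zero_iff.1 (c.b_mem i))

theorem length_nonneg (c : DiscChain D x y) : 0 ≤ c.length :=
  Finset.sum_nonneg fun i _ => c.poincareDist_nonneg i

/-- The constant chain without discs. -/
def refl (D : Set (Cn n)) (x : Cn n) : DiscChain D x x where
  k := 0
  p := fun _ => x
  f := Fin.elim0
  a := Fin.elim0
  b := Fin.elim0
  start_eq := rfl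
  end_eq := rfl
  a_mem := fun i => i.elim0
  b_mem := fun i => i.elim0
  differentiableOn := fun i => i.elim0
  mapsTo := fun i => i.elim0
  map_a := fun i => i.elim0
  map_b := fun i => i.elim0

/-- The chain run backwards. -/
def symm (c : DiscChain D x y) : DiscChain D y x where
  k := c.k
  p := fun i => c.p i.rev
  f := fun i => c.f i.rev
  a := fun i => c.b i.rev
  b := fun i => c.a i.rev
  start_eq := by simp [c.end_eq]
  end_eq := by simp [c.start_eq]
  a_mem := fun i => c.b_mem _
  b_mem := fun i => c.a_mem _
  differentiableOn := fun i => c.differentiableOn _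
  mapsTo := fun i => c.mapsTo _
  map_a := fun i => by rw [c.map_b, Fin.rev_castSucc]
  map_b := fun i => by rw [c.map_a, Fin.rev_succ]

theorem length_refl (D : Set (Cn n)) (x : Cn n) : (refl D x).length = 0 :=
  Finset.sum_eq_zero fun i => i.elim0

theorem length_symm (c : DiscChain D x y) : c.symm.length = c.length := by
  change ∑ i : Fin c.k, poincareDist (c.b i.rev) (c.a i.rev) = ∑ i, poincareDist (c.a i) (c.b i)
  rw [← Equiv.sum_comp Fin.revPerm fun i => poincareDist (c.a i) (c.b i)]
  exact Finset.sum_congr rfl fun i _ => poincareDist_comm _ _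

/-- A chain preceded by one more disc. -/
def cons (f : ℂ → Cn n) (a b : ℂ) (ha : a ∈ Metric.ball (0 : ℂ) 1) (hb : b ∈ Metric.ball (0 : ℂ) 1)
    (hf : DifferentiableOn ℂ f (Metric.ball 0 1)) (hfD : MapsTo f (Metric.ball 0 1) D)
    (hx : f a = x) (hy : f b = y) (c : DiscChain D y z) : DiscChain D x z where
  k := c.k + 1
  p := Fin.cons x c.p
  f := Fin.cons f c.f
  a := Fin.cons a c.a
  b := Fin.cons b c.b
  start_eq := rfl
  end_eq := by rw [← Fin.succ_last, Fin.cons_succ, c.end_eq]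
  a_mem := Fin.cases ha c.a_mem
  b_mem := Fin.cases hb c.b_mem
  differentiableOn := Fin.cases hf c.differentiableOn
  mapsTo := Fin.cases hfD c.mapsTo
  map_a := Fin.cases hx fun i => by
    rw [← Fin.succ_castSucc, Fin.cons_succ, Fin.cons_succ, Fin.cons_succ, c.map_a]
  map_b := Fin.cases (by simp [hy, c.start_eq]) fun i => by
    rw [Fin.cons_succ, Fin.cons_succ, Fin.cons_succ, c.map_b]

theorem length_cons (f : ℂ → Cn n) (a b : ℂ) (ha hb hf hfD) (hx : f a = x) (hy : f b = y)
    (c : DiscChain D y z) :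
    (cons f a b ha hb hf hfD hx hy c).length = poincareDist a b + c.length := by
  change ∑ i : Fin (c.k + 1), _ = _
  rw [Fin.sum_univ_succ]
  rfl

/-- Induction on the number of discs of the first chain, peeling off its first disc; the starting
point `x` varies because the tail starts elsewhere. -/
theorem exists_trans (c' : DiscChain D y z) : ∀ (k : ℕ) (x : Cn n) (c : DiscChain D x y),
    c.k = k → ∃ e : DiscChain D x z, e.length = c.length + c'.length
  | 0, x, ⟨_, p, f, a, b, hs, he, ha, hb, hf, hm, hfa, hfb⟩, rfl => by
    obtain rfl : x = y := by rw [← hs, ← he]; rfl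
    exact ⟨c', by simp [length]⟩
  | k + 1, x, ⟨_, p, f, a, b, hs, he, ha, hb, hf, hm, hfa, hfb⟩, rfl => by
    let t : DiscChain D (p (Fin.succ 0)) y :=
      { k := k
        p := fun i => p i.succ
        f := fun i => f i.succ
        a := fun i => a i.succ
        b := fun i => b i.succ
        start_eq := rfl
        end_eq := by rw [Fin.succ_last, he]
        a_mem := fun i => ha _
        b_mem := fun i => hb _
        differentiableOn := fun i => hf _
        mapsTo := fun i => hm _
        map_a := fun i => by rw [hfa, Fin.succ_castSucc]
        map_b := fun i => hfb _ }
    obtain ⟨e, he⟩ := exists_trans c' k _ t rfl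
    refine ⟨cons (f 0) (a 0) (b 0) (ha 0) (hb 0) (hf 0) (hm 0) ((hfa 0).trans hs) (hfb 0) e, ?_⟩
    rw [length_cons, he]
    simp only [length]
    rw [Fin.sum_univ_succ, add_assoc]

theorem norm_sub_le_length {E : Type*} [NormedAddCommGroup E] [NormedSpace ℂ E]
    {g : Cn n → E} (hg : DifferentiableOn ℂ g D) (hgm : MapsTo g D (Metric.ball 0 1))
    (c : DiscChain D x y) : ‖g x - g y‖ ≤ 2 * c.length := by
  have h := dist_le_fin_sum_dist c.k fun i => g (c.p i)
  rw [c.start_eq, c.end_eq, dist_eq_norm] at h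
  refine h.trans ?_
  rw [length, Finset.mul_sum]
  refine Finset.sum_le_sum fun i _ => ?_
  rw [dist_eq_norm, ← c.map_a, ← c.map_b]
  exact norm_sub_le_poincareDist (g := g ∘ c.f i)
    (hg.comp (c.differentiableOn i) (c.mapsTo i)) (hgm.comp (c.mapsTo i))
    (mem_ball_zero_iff.1 (c.a_mem i)) (mem_ball_zero_iff.1 (c.b_mem i))

end DiscChain

theorem kobayashiDist_le_of_ball_subset {n : ℕ} {D : Set (Cn n)} {x y : Cn n} {r : ℝ} (hr : 0 < r)
    (hD : Metric.ball x r ⊆ D) (hy : ‖y - x‖ < r) :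
    kobayashiDist D x y ≤
      ENNReal.ofReal (Real.log ((1 + ‖y - x‖ / r) / (1 - ‖y - x‖ / r))) := by
  rcases eq_or_ne y x with rfl | hyx
  · exact (iInf_le _ (DiscChain.refl D y)).trans (by simp [DiscChain.length_refl])
  have hpos : 0 < ‖y - x‖ := norm_pos_iff.2 (sub_ne_zero.2 hyx)
  -- The affine disc of radius `r` centred at `x` through `y`, which is reached at the parameter `‖y
  -- - x‖ / r`.
  let f : ℂ → Cn n := fun z => x + (z * ((r / ‖y - x‖ : ℝ) : ℂ)) • (y - x)
  have hnorm : ∀ z, ‖f z - x‖ = ‖z‖ * r := fun z => by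
    simp only [f, add_sub_cancel_left, norm_smul, norm_mul, Complex.norm_real, Real.norm_eq_abs,
      abs_of_pos (div_pos hr hpos)]
    field_simp
  have hb : ‖(((‖y - x‖ / r : ℝ)) : ℂ)‖ = ‖y - x‖ / r := by
    rw [Complex.norm_real, Real.norm_of_nonneg (by positivity)]
  have hfD : MapsTo f (Metric.ball 0 1) D := fun z hz => hD (by
    rw [Metric.mem_ball, dist_eq_norm, hnorm]
    rw [mem_ball_zero_iff] at hz
    nlinarith)
  let c : DiscChain D x y := DiscChain.cons f 0 ((‖y - x‖ / r : ℝ) : ℂ) (by simp)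
    (by rw [mem_ball_zero_iff, hb]; exact (div_lt_one hr).2 hy) (by fun_prop)
    hfD (by simp [f])
    (by
      simp only [f]
      rw [← Complex.ofReal_mul, show ‖y - x‖ / r * (r / ‖y - x‖) = 1 by field_simp]
      simp) (DiscChain.refl D y)
  refine (iInf_le _ c).trans (le_of_eq ?_)
  rw [show c.length = _ from DiscChain.length_cons ..]
  rw [DiscChain.length_refl, add_zero, poincareDist]
  simp only [map_zero, zero_mul, sub_zero, div_one, zero_sub, norm_neg, hb]

theorem isCompleteMetricOn_kobayashiDist {n : ℕ} {D : Set (Cn n)}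
    (hD : IsHolomorphicHomogeneousRegular D) : IsCompleteMetricOn D (kobayashiDist D) := by
  refine hD.isCompleteMetricOn _ (fun x _ => ?_) (fun x _ y _ => ?_) (fun x _ y _ z _ => ?_)
    (fun x hx ε hε => ?_) (fun f hf hfm x _ y _ => ?_)
  · exact le_antisymm ((iInf_le _ (DiscChain.refl D x)).trans
      (by simp [DiscChain.length_refl])) bot_le
  · refine le_iInf fun c => (iInf_le _ c.symm).trans ?_
    rw [c.length_symm]
  · unfold kobayashiDist
    refine ENNReal.le_iInf_add_iInf fun c c' => ?_
    obtain ⟨e, he⟩ := DiscChain.exists_trans c' _ x c rfl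
    refine (iInf_le _ e).trans ?_
    rw [he, ENNReal.ofReal_add c.length_nonneg c'.length_nonneg]
  · obtain ⟨r, hr, hrD⟩ := Metric.isOpen_iff.1 hD.isOpen x hx
    have hcont : Tendsto (fun y : Cn n =>
        ENNReal.ofReal (Real.log ((1 + ‖y - x‖ / r) / (1 - ‖y - x‖ / r)))) (𝓝 x) (𝓝 0) := by
      have h1 : ContinuousAt (fun y : Cn n =>
          Real.log ((1 + ‖y - x‖ / r) / (1 - ‖y - x‖ / r))) x := by
        refine ContinuousAt.log (ContinuousAt.div (by fun_prop) (by fun_prop) (by simp)) (by simp)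
      have h2 := ENNReal.continuous_ofReal.continuousAt.tendsto.comp h1.tendsto
      simpa [Function.comp_def] using h2
    filter_upwards [hcont.eventually (gt_mem_nhds hε), Metric.ball_mem_nhds x hr] with y hy hyr
    exact (kobayashiDist_le_of_ball_subset hr hrD (by simpa [dist_eq_norm] using hyr)).trans_lt hy
  · unfold kobayashiDist
    rw [ENNReal.mul_iInf_of_ne (by simp) (by simp)]
    refine le_iInf fun c => ?_
    refine (ENNReal.ofReal_le_ofReal (c.norm_sub_le_length hf hfm)).trans_eq ?_
    rw [ENNReal.ofReal_mul (by norm_num), ENNReal.ofReal_ofNat]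

/-! ### Holomorphic maps of several variables -/

section Holomorphic

variable {E F V : Type*} [NormedAddCommGroup E] [NormedSpace ℂ E] [NormedAddCommGroup F]
  [NormedSpace ℂ F] [NormedAddCommGroup V] [NormedSpace ℂ V]

theorem norm_fderiv_le_of_norm_le {f : E → F} {c : E} {R M : ℝ} (hR : 0 < R)
    (hf : DifferentiableOn ℂ f (Metric.ball c R)) (hM : ∀ z ∈ Metric.ball c R, ‖f z‖ ≤ M) :
    ‖fderiv ℂ f c‖ ≤ 2 * M / R :=
  Complex.norm_fderiv_le_div_of_mapsTo_ball hf (fun z hz => by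
    rw [Metric.mem_closedBall, dist_eq_norm]
    have := hM c (Metric.mem_ball_self hR)
    have := hM z hz
    exact (norm_sub_le _ _).trans (by linarith)) hR

/-- A second order Cauchy estimate. -/
theorem norm_sub_sub_fderiv_le {f : E → F} {c z : E} {R M : ℝ}
    (hf : DifferentiableOn ℂ f (Metric.ball c R)) (hM : ∀ z ∈ Metric.ball c R, ‖f z‖ ≤ M)
    (hz : z ∈ Metric.ball c R) :
    ‖f z - f c - fderiv ℂ f c (z - c)‖ ≤ 4 * M * (‖z - c‖ / R) ^ 2 := by
  have hR : 0 < R := Metric.nonempty_ball.1 ⟨z, hz⟩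
  have hc := Metric.mem_ball_self (x := c) hR
  -- Removing the linear part leaves `g w - g c = o(‖w - c‖)`, so the higher-order Schwarz lemma
  -- gives quadratic decay. The constant `4 * M` is `M` for each of `f w` and `f c`, plus `2 * M`
  -- for the linear part.
  let g : E → F := fun w => f w - fderiv ℂ f c (w - c)
  have hg : DifferentiableOn ℂ g (Metric.ball c R) :=
    hf.sub (by fun_prop)
  have hgc : g c = f c := by simp [g]
  have hD := norm_fderiv_le_of_norm_le hR hf hM
  have hmaps : MapsTo g (Metric.ball c R) (Metric.closedBall (g c) (4 * M)) := fun w hw => by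
    rw [Metric.mem_closedBall, dist_eq_norm, hgc]
    have h1 := hM w hw
    have h2 := hM c hc
    have h3 : ‖fderiv ℂ f c (w - c)‖ ≤ 2 * M / R * R := by
      refine (ContinuousLinearMap.le_opNorm _ _).trans ?_
      have h4 : ‖w - c‖ ≤ R := by
        rw [← dist_eq_norm]; exact (Metric.mem_ball.1 hw).le
      exact mul_le_mul hD h4 (norm_nonneg _) ((norm_nonneg _).trans hD)
    rw [div_mul_cancel₀ _ hR.ne'] at h3
    calc ‖g w - f c‖ ≤ ‖g w‖ + ‖f c‖ := norm_sub_le _ _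
      _ ≤ (‖f w‖ + ‖fderiv ℂ f c (w - c)‖) + ‖f c‖ := by gcongr; exact norm_sub_le _ _
      _ ≤ 4 * M := by linarith
  have ho : (g · - g c) =o[𝓝 c] (fun w => ‖w - c‖ ^ 1) := by
    have h := (hf.differentiableAt (Metric.isOpen_ball.mem_nhds hc)).hasFDerivAt.isLittleO
    simp only [pow_one]
    refine (h.norm_right).congr_left fun w => ?_
    simp only [g, hgc]
    abel
  have h := Complex.dist_le_mul_div_pow_of_mapsTo_ball_of_isLittleO hg hmaps ho hz
  rw [dist_eq_norm, dist_eq_norm, hgc] at h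
  rwa [show g z - f c = f z - f c - fderiv ℂ f c (z - c) by simp only [g]; abel] at h

theorem _root_.HasFDerivAt.of_norm_sub_sub_le {T : E → F} {L : E →L[ℂ] F} {c : E} {R C : ℝ}
    (hR : 0 < R) (h : ∀ z ∈ Metric.ball c R, ‖T z - T c - L (z - c)‖ ≤ C * ‖z - c‖ ^ 2) :
    HasFDerivAt T L c := by
  refine HasFDerivAt.of_isLittleO ?_
  refine (Asymptotics.IsBigO.of_bound (g := fun z => ‖z - c‖ ^ 2) C ?_).trans_isLittleO ?_
  · filter_upwards [Metric.ball_mem_nhds c hR] with z hz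
    simpa using h z hz
  · have h1 : (fun z : E => z - c) =o[𝓝 c] (fun _ => (1 : ℝ)) := by
      rw [Asymptotics.isLittleO_one_iff]
      exact tendsto_sub_nhds_zero_iff.2 tendsto_id
    have h2 := h1.norm_left.mul_isBigO (Asymptotics.isBigO_refl (fun z : E => ‖z - c‖) (𝓝 c))
    simp only [one_mul] at h2
    exact (h2.norm_right.congr_left fun z => (sq _).symm).trans_isBigO
      (by simpa using (Asymptotics.isBigO_refl (fun z : E => z - c) (𝓝 c)))

/-- Uniform limits of holomorphic maps are holomorphic. -/
theorem _root_.TendstoUniformlyOn.differentiableOn_complex [CompleteSpace F]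
    {G : ℕ → E → F} {g : E → F} {U : Set E} (hU : IsOpen U)
    (h : TendstoUniformlyOn G g atTop U) (hG : ∀ i, DifferentiableOn ℂ (G i) U) :
    DifferentiableOn ℂ g U := by
  intro z₀ hz₀
  obtain ⟨ρ, hρ, hρU⟩ := Metric.mem_nhds_iff.1 (hU.mem_nhds hz₀)
  obtain ⟨r, hr, rfl⟩ : ∃ r, 0 < r ∧ ρ = r + r := ⟨ρ / 2, by positivity, by ring⟩
  have hball : ∀ z ∈ Metric.ball z₀ r, Metric.ball z r ⊆ U := fun z hz =>
    (Metric.ball_subset_ball' (by linarith [Metric.mem_ball.1 hz])).trans hρU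
  have hdiff : ∀ i, ∀ z ∈ Metric.ball z₀ r, DifferentiableAt ℂ (G i) z := fun i z hz =>
    (hG i).differentiableAt (hU.mem_nhds (hball z hz (Metric.mem_ball_self hr)))
  -- Cauchy's estimate on balls of fixed radius `r` passes the uniform Cauchy property to the
  -- derivatives: `ε * r / 8` twice gives `ε * r / 4`, hence a derivative bound `ε / 2`.
  have hcauchy : UniformCauchySeqOn (fun i => fderiv ℂ (G i)) atTop (Metric.ball z₀ r) := by
    rw [Metric.uniformCauchySeqOn_iff]
    intro ε hε
    obtain ⟨N, hN⟩ := eventually_atTop.1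
      (Metric.tendstoUniformlyOn_iff.1 h (ε * r / 8) (by positivity))
    refine ⟨N, fun i hi j hj z hz => ?_⟩
    rw [dist_eq_norm, ← fderiv_sub (hdiff i z hz) (hdiff j z hz)]
    refine (norm_fderiv_le_of_norm_le (M := ε * r / 4) hr
      (((hG i).sub (hG j)).mono (hball z hz)) fun w hw => ?_).trans_lt ?_
    · rw [Pi.sub_apply, ← dist_eq_norm]
      have h1 := hN i hi w (hball z hz hw)
      have h2 := hN j hj w (hball z hz hw)
      linarith [dist_triangle_left (G i w) (G j w) (g w)]
    · rw [div_lt_iff₀ hr]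
      nlinarith
  have hlim : ∀ z ∈ Metric.ball z₀ r, ∃ L, Tendsto (fun i => fderiv ℂ (G i) z) atTop (𝓝 L) :=
    fun z hz => cauchySeq_tendsto_of_complete (hcauchy.cauchySeq hz)
  choose! g' hg' using hlim
  exact (hasFDerivAt_of_tendstoUniformlyOn Metric.isOpen_ball
    (hcauchy.tendstoUniformlyOn_of_tendsto hg') (fun i z hz => (hdiff i z hz).hasFDerivAt)
    (fun z hz => h.tendsto_at (hball z hz (Metric.mem_ball_self hr)))
    (Metric.mem_ball_self hr)).differentiableAt.differentiableWithinAt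

/-- A locally bounded family of functionals depending holomorphically on a parameter in the weak
sense does so in the norm sense. -/
theorem differentiableOn_of_forall_apply {T : E → V →L[ℂ] ℂ} {U : Set E}
    (hT : ∀ v, DifferentiableOn ℂ (fun z => T z v) U)
    (hb : ∀ z ∈ U, ∃ r > 0, ∃ M, Metric.ball z r ⊆ U ∧ ∀ w ∈ Metric.ball z r, ‖T w‖ ≤ M) :
    DifferentiableOn ℂ T U := by
  intro z₀ hz₀
  obtain ⟨r, hr, M, hrU, hM⟩ := hb z₀ hz₀
  have hdiff : ∀ v, DifferentiableAt ℂ (fun z => T z v) z₀ := fun v =>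
    ((hT v).mono hrU).differentiableAt (Metric.ball_mem_nhds _ hr)
  have hbound : ∀ v, ∀ w ∈ Metric.ball z₀ r, ‖T w v‖ ≤ M * ‖v‖ := fun v w hw =>
    (T w).le_of_opNorm_le (hM w hw) v
  -- The candidate derivative is assembled from the weak derivatives. The second-order estimate has
  -- a constant proportional to `‖v‖`, so the remainder is quadratic in operator norm.
  let L : E →L[ℂ] V →L[ℂ] ℂ := LinearMap.mkContinuous₂
    (LinearMap.mk₂ ℂ (fun e v => fderiv ℂ (fun z => T z v) z₀ e)
      (fun _ _ _ => map_add _ _ _) (fun _ _ _ => map_smul _ _ _)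
      (fun e v w => by
        simp only [map_add]
        rw [fderiv_fun_add (hdiff v) (hdiff w)]; rfl)
      (fun c e v => by
        simp only [map_smul]
        rw [fderiv_fun_const_smul (hdiff v)]; rfl)) (2 * M / r) (fun e v => by
      simp only [LinearMap.mk₂_apply]
      refine (ContinuousLinearMap.le_opNorm _ _).trans ?_
      have := norm_fderiv_le_of_norm_le hr ((hT v).mono hrU) (hbound v)
      calc _ ≤ (2 * (M * ‖v‖) / r) * ‖e‖ := by gcongr
        _ = _ := by ring)
  refine (HasFDerivAt.of_norm_sub_sub_le (L := L) (C := 4 * M / r ^ 2) hr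
    fun z hz => ?_).differentiableAt.differentiableWithinAt
  have hM0 : 0 ≤ M := (norm_nonneg _).trans (hM z hz)
  refine ContinuousLinearMap.opNorm_le_bound _ (by positivity) fun v => ?_
  have := norm_sub_sub_fderiv_le ((hT v).mono hrU) (hbound v) hz
  calc _ = ‖T z v - T z₀ v - fderiv ℂ (fun z => T z v) z₀ (z - z₀)‖ := rfl
    _ ≤ _ := this
    _ = _ := by ring

/-- Directional derivatives of holomorphic maps are holomorphic. -/
theorem _root_.DifferentiableOn.fderiv_apply_complex [CompleteSpace F] {f : E → F} {U : Set E}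
    (hf : DifferentiableOn ℂ f U) (hU : IsOpen U) (v : E) :
    DifferentiableOn ℂ (fun z => fderiv ℂ f z v) U := by
  intro z₀ hz₀
  have hcont : ContinuousAt f z₀ := (hf.differentiableAt (hU.mem_nhds hz₀)).continuousAt
  obtain ⟨ρ, hρ, hρU⟩ := Metric.mem_nhds_iff.1 (inter_mem (hU.mem_nhds hz₀)
    (hcont.norm.eventually_lt_const (lt_add_one ‖f z₀‖)))
  set M := ‖f z₀‖ + 1
  obtain ⟨r, hr, rfl⟩ : ∃ r, 0 < r ∧ ρ = r + r := ⟨ρ / 2, by positivity, by ring⟩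
  -- Step sizes tending to 0 and keeping `z + h m • v` in the larger ball. The difference quotients
  -- are holomorphic and converge uniformly, with error proportional to `h m`.
  let h : ℕ → ℝ := fun m => r / (‖v‖ + 1) / (m + 1)
  have hpos : ∀ m, 0 < h m := fun m => by positivity
  have hv : ∀ m, ‖((h m : ℝ) : ℂ) • v‖ < r := fun m => by
    rw [norm_smul, Complex.norm_real, Real.norm_of_nonneg (hpos m).le]
    have h1 : h m ≤ r / (‖v‖ + 1) := div_le_self (by positivity) (by simp)
    calc h m * ‖v‖ ≤ r / (‖v‖ + 1) * ‖v‖ := by gcongr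
      _ < r / (‖v‖ + 1) * (‖v‖ + 1) := by
        have : 0 < r / (‖v‖ + 1) := by positivity
        nlinarith
      _ = r := by field_simp
  have hmem : ∀ m, ∀ z ∈ Metric.ball z₀ r, z + ((h m : ℝ) : ℂ) • v ∈ Metric.ball z₀ (r + r) := by
    intro m z hz
    rw [Metric.mem_ball, dist_eq_norm] at hz ⊢
    rw [add_sub_right_comm]
    exact (norm_add_le _ _).trans_lt (add_lt_add hz (hv m))
  have hsub : Metric.ball z₀ r ⊆ Metric.ball z₀ (r + r) := Metric.ball_subset_ball (by linarith)
  have hf' : DifferentiableOn ℂ f (Metric.ball z₀ (r + r)) :=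
    hf.mono fun z hz => (hρU hz).1
  have key : DifferentiableOn ℂ (fun z => fderiv ℂ f z v) (Metric.ball z₀ r) := by
    refine TendstoUniformlyOn.differentiableOn_complex
      (G := fun (m : ℕ) z => ((h m : ℝ) : ℂ)⁻¹ • (f (z + ((h m : ℝ) : ℂ) • v) - f z))
      Metric.isOpen_ball ?_ fun m => ?_
    · have hlim : Tendsto (fun m => 4 * M * ‖v‖ ^ 2 / r ^ 2 * h m) atTop (𝓝 0) := by
        rw [← mul_zero (4 * M * ‖v‖ ^ 2 / r ^ 2)]
        refine Tendsto.const_mul _ ?_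
        have h1 := tendsto_one_div_add_atTop_nhds_zero_nat (𝕜 := ℝ) |>.const_mul (r / (‖v‖ + 1))
        simpa only [mul_zero, mul_one_div] using h1
      rw [Metric.tendstoUniformlyOn_iff]
      intro ε hε
      filter_upwards [hlim.eventually_lt_const hε] with m hm z hz
      refine lt_of_le_of_lt ?_ hm
      have hball : Metric.ball z r ⊆ Metric.ball z₀ (r + r) :=
        Metric.ball_subset_ball' (by linarith [Metric.mem_ball.1 hz])
      have h1 := norm_sub_sub_fderiv_le (z := z + ((h m : ℝ) : ℂ) • v) (M := M)
        (hf'.mono hball) (fun w hw => (hρU (hball hw)).2.le)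
        (by rw [Metric.mem_ball, dist_eq_norm, add_sub_cancel_left]; exact hv m)
      have hne : ((h m : ℝ) : ℂ) ≠ 0 := by exact_mod_cast (hpos m).ne'
      rw [add_sub_cancel_left, map_smul] at h1
      rw [dist_eq_norm, norm_sub_rev]
      have h2 : ((h m : ℝ) : ℂ)⁻¹ • (f (z + ((h m : ℝ) : ℂ) • v) - f z) - fderiv ℂ f z v =
          ((h m : ℝ) : ℂ)⁻¹ • (f (z + ((h m : ℝ) : ℂ) • v) - f z -
            ((h m : ℝ) : ℂ) • fderiv ℂ f z v) := by
        rw [smul_sub _ _ (((h m : ℝ) : ℂ) • fderiv ℂ f z v), inv_smul_smul₀ hne]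
      rw [h2, norm_smul, norm_inv, Complex.norm_real, Real.norm_of_nonneg (hpos m).le]
      rw [norm_smul, Complex.norm_real, Real.norm_of_nonneg (hpos m).le] at h1
      calc _ ≤ (h m)⁻¹ * (4 * M * (h m * ‖v‖ / r) ^ 2) := by
            have := (hpos m).le
            gcongr
        _ = _ := by
          have := (hpos m).ne'
          field_simp
    · refine DifferentiableOn.const_smul (DifferentiableOn.sub ?_ (hf'.mono hsub)) _
      exact hf'.comp (by fun_prop) (hmem m)
  exact (key.differentiableAt (Metric.ball_mem_nhds _ hr)).differentiableWithinAt

end Holomorphic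

section BergmanSpace

/-! ### The Bergman space -/

/-- Multiplication by a unit complex number, as a real linear isometry. -/
def rotation (n : ℕ) (c : ℂ) (hc : ‖c‖ = 1) : Cn n ≃ₗᵢ[ℝ] Cn n where
  toLinearEquiv := (LinearEquiv.smulOfNeZero ℂ (Cn n) c (by rintro rfl; simp at hc)).restrictScalars ℝ
  norm_map' v := by
    change ‖c • v‖ = ‖v‖
    rw [norm_smul, hc, one_mul]

theorem setIntegral_closedBall_rotation {n : ℕ} (g : Cn n → ℂ) (r : ℝ) (c : ℂ) (hc : ‖c‖ = 1) :
    ∫ v in Metric.closedBall (0 : Cn n) r, g (c • v) = ∫ v in Metric.closedBall (0 : Cn n) r, g v := by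
  have h := (rotation n c hc).measurePreserving.setIntegral_preimage_emb
    (rotation n c hc).toMeasurableEquiv.measurableEmbedding g (Metric.closedBall 0 r)
  have h1 : (rotation n c hc) ⁻¹' Metric.closedBall 0 r = Metric.closedBall 0 r := by
    ext v
    simp
  rw [h1] at h
  exact h

/-- The mean value property of holomorphic functions on balls. -/
theorem setIntegral_closedBall_eq {n : ℕ} {f : Cn n → ℂ} {U : Set (Cn n)} {z : Cn n} {r : ℝ}
    (hU : IsOpen U) (hf : DifferentiableOn ℂ f U) (hr : Metric.closedBall z r ⊆ U) :
    ∫ v in Metric.closedBall z r, f v = (volume.real (Metric.closedBall (0 : Cn n) r) : ℂ) * f z := by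
  let B := Metric.closedBall (0 : Cn n) r
  let g : Cn n → ℂ := fun v => f (z + v)
  have hzB : ∀ v ∈ B, ∀ c : ℂ, ‖c‖ ≤ 1 → z + c • v ∈ U := fun v hv c hc => hr (by
    have hv' : ‖v‖ ≤ r := mem_closedBall_zero_iff.1 hv
    rw [Metric.mem_closedBall, dist_eq_norm, add_sub_cancel_left, norm_smul]
    nlinarith [norm_nonneg v, norm_nonneg c])
  have htrans : ∫ v in Metric.closedBall z r, f v = ∫ v in B, g v := by
    have h := (measurePreserving_add_left (volume : Measure (Cn n)) z).setIntegral_preimage_emb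
      (measurableEmbedding_addLeft z) f (Metric.closedBall z r)
    have h1 : (fun v => z + v) ⁻¹' Metric.closedBall z r = B := by
      ext v; simp [B]
    rw [h1] at h
    exact h.symm
  -- One-variable mean value property on the complex line through `z` in direction `v`. Integrating
  -- over `v`, exchanging integrals and using rotation invariance of the ball makes the angular
  -- average disappear.
  have hcirc : ∀ v ∈ B, ∫ θ in (0 : ℝ)..2 * Real.pi, g (circleMap 0 1 θ • v) =
      (2 * Real.pi : ℝ) • f z := fun v hv => by
    have hd : DiffContOnCl ℂ (fun c : ℂ => g (c • v)) (Metric.ball 0 |(1 : ℝ)|) := by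
      refine DifferentiableOn.diffContOnCl_ball (U := Metric.closedBall 0 1) ?_ (by simp)
      intro c hc
      have h1 := hf.differentiableAt (hU.mem_nhds (hzB v hv c (mem_closedBall_zero_iff.1 hc)))
      have h2 : DifferentiableAt ℂ (fun c : ℂ => z + c • v) c := by fun_prop
      exact (DifferentiableAt.comp c h1 h2).differentiableWithinAt
    have h := hd.circleAverage
    rw [Real.circleAverage_def, inv_smul_eq_iff₀ (by positivity)] at h
    simpa [g] using h
  have hswap : ∫ θ in (0 : ℝ)..2 * Real.pi, ∫ v in B, g (circleMap 0 1 θ • v) =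
      ∫ v in B, ∫ θ in (0 : ℝ)..2 * Real.pi, g (circleMap 0 1 θ • v) := by
    refine intervalIntegral_integral_swap ?_
    rw [Measure.prod_restrict, ← Measure.volume_eq_prod, ← IntegrableOn]
    have hcomp : IsCompact (uIcc 0 (2 * Real.pi) ×ˢ B) :=
      isCompact_uIcc.prod (isCompact_closedBall _ _)
    refine (ContinuousOn.integrableOn_compact hcomp ?_).mono_set
      (prod_mono uIoc_subset_uIcc subset_rfl)
    refine hf.continuousOn.comp (f := fun p : ℝ × Cn n => z + circleMap 0 1 p.1 • p.2)
      (by fun_prop) fun p hp => hzB _ hp.2 _ (by simp)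
  have hrot : ∀ θ : ℝ, ∫ v in B, g (circleMap 0 1 θ • v) = ∫ v in B, g v := fun θ =>
    setIntegral_closedBall_rotation g r _ (by simp)
  rw [setIntegral_congr_fun Metric.isClosed_closedBall.measurableSet hcirc] at hswap
  simp only [hrot, intervalIntegral.integral_const, setIntegral_const, sub_zero, smul_smul] at hswap
  rw [htrans]
  have hmean : ∫ v in B, g v = volume.real B • f z :=
    smul_right_injective ℂ (by positivity : (2 * Real.pi) ≠ 0) (by
      simp only [smul_smul]
      rw [hswap, mul_comm])
  rw [hmean, Complex.real_smul]

variable {n : ℕ} {D : Set (Cn n)}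

/-- The square integrable holomorphic functions on `D` as a subspace of `L²(D)`. -/
def bergmanSubmodule (D : Set (Cn n)) : Submodule ℂ (Lp ℂ 2 (volume.restrict D)) where
  carrier := {F | ∃ f : Cn n → ℂ, DifferentiableOn ℂ f D ∧ F =ᵐ[volume.restrict D] f}
  zero_mem' := ⟨fun _ => 0, differentiableOn_const _, Lp.coeFn_zero _ _ _⟩
  add_mem' := by
    rintro F G ⟨f, hf, hFf⟩ ⟨g, hg, hGg⟩
    exact ⟨f + g, hf.add hg, (Lp.coeFn_add F G).trans (hFf.add hGg)⟩
  smul_mem' := by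
    rintro c F ⟨f, hf, hFf⟩
    exact ⟨c • f, hf.const_smul c, (Lp.coeFn_smul c F).trans (hFf.const_smul c)⟩

/-- The mean over a closed ball in `D` around `z` as a functional on `L²(D)`. -/
def ballMean (D : Set (Cn n)) (z : Cn n) (r : ℝ) : Lp ℂ 2 (volume.restrict D) →L[ℂ] ℂ :=
  ((volume.real (Metric.closedBall (0 : Cn n) r) : ℂ))⁻¹ •
    innerSL ℂ (indicatorConstLp 2 (μ := volume.restrict D)
      (Metric.isClosed_closedBall (x := z) (ε := r)).measurableSet
      (isCompact_closedBall z r).measure_lt_top.ne 1)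

theorem volume_closedBall_pos (n : ℕ) {r : ℝ} (hr : 0 < r) :
    0 < volume.real (Metric.closedBall (0 : Cn n) r) :=
  ENNReal.toReal_pos (Metric.measure_closedBall_pos _ _ hr).ne'
    (isCompact_closedBall _ _).measure_lt_top.ne

theorem ballMean_eq (hD : IsOpen D) {z : Cn n} {r : ℝ} (hr : 0 < r)
    (hz : Metric.closedBall z r ⊆ D) {F : Lp ℂ 2 (volume.restrict D)} {f : Cn n → ℂ}
    (hf : DifferentiableOn ℂ f D) (hFf : F =ᵐ[volume.restrict D] f) : ballMean D z r F = f z := by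
  have hV : (volume.real (Metric.closedBall (0 : Cn n) r) : ℂ) ≠ 0 :=
    Complex.ofReal_ne_zero.2 (volume_closedBall_pos n hr).ne'
  rw [ballMean, smul_apply, innerSL_apply_apply,
    L2.inner_indicatorConstLp_one, smul_eq_mul,
    Measure.restrict_restrict Metric.isClosed_closedBall.measurableSet,
    inter_eq_self_of_subset_left hz,
    integral_congr_ae (ae_mono (Measure.restrict_mono hz le_rfl) hFf),
    setIntegral_closedBall_eq hD hf hz, inv_mul_cancel_left₀ hV]

/-- The operator norm of the mean over a ball of radius `r` is at most this number. -/
def ballMeanBound (n : ℕ) (r : ℝ) : ℝ :=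
  (volume.real (Metric.closedBall (0 : Cn n) r))⁻¹ *
    volume.real (Metric.closedBall (0 : Cn n) r) ^ (1 / 2 : ℝ)

theorem norm_ballMean_le {z : Cn n} {r : ℝ} (hz : Metric.closedBall z r ⊆ D) :
    ‖ballMean D z r‖ ≤ ballMeanBound n r := by
  have h0 : (volume.restrict D).real (Metric.closedBall z r) =
      volume.real (Metric.closedBall (0 : Cn n) r) := by
    simp only [measureReal_def]
    rw [Measure.restrict_apply Metric.isClosed_closedBall.measurableSet,
      inter_eq_self_of_subset_left hz, Measure.addHaar_closedBall_center]
  rw [ballMean, norm_smul, innerSL_apply_norm,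
    norm_indicatorConstLp (by simp) (by simp), h0]
  simp [ballMeanBound, abs_of_nonneg measureReal_nonneg]

theorem ballMeanBound_nonneg (n : ℕ) (r : ℝ) : 0 ≤ ballMeanBound n r :=
  mul_nonneg (inv_nonneg.2 measureReal_nonneg) (Real.rpow_nonneg measureReal_nonneg _)

theorem norm_apply_le_ballMeanBound (hD : IsOpen D) {z : Cn n} {r : ℝ} (hr : 0 < r)
    (hz : Metric.closedBall z r ⊆ D) {F : Lp ℂ 2 (volume.restrict D)} {f : Cn n → ℂ}
    (hf : DifferentiableOn ℂ f D) (hFf : F =ᵐ[volume.restrict D] f) :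
    ‖f z‖ ≤ ballMeanBound n r * ‖F‖ := by
  rw [← ballMean_eq hD hr hz hf hFf]
  exact (ballMean D z r).le_of_opNorm_le (norm_ballMean_le hz) F

/-! ### Point evaluations on the Bergman space -/

theorem exists_closedBall_subset (hD : IsOpen D) {z : Cn n} (hz : z ∈ D) :
    ∃ r > 0, Metric.closedBall z r ⊆ D :=
  Metric.nhds_basis_closedBall.mem_iff.1 (hD.mem_nhds hz)

/-- A uniform version of `exists_closedBall_subset`. -/
theorem exists_closedBall_subset_of_ball (hD : IsOpen D) {z : Cn n} (hz : z ∈ D) :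
    ∃ r > 0, Metric.ball z r ⊆ D ∧ ∀ w ∈ Metric.ball z r, Metric.closedBall w r ⊆ D := by
  obtain ⟨r, hr, hrD⟩ := exists_closedBall_subset hD hz
  refine ⟨r / 2, by positivity, ?_, fun w hw => ?_⟩
  · exact Metric.ball_subset_closedBall.trans
      ((Metric.closedBall_subset_closedBall (by linarith)).trans hrD)
  · exact (Metric.closedBall_subset_closedBall' (by linarith [Metric.mem_ball.1 hw])).trans hrD

open scoped Classical in
/-- A functional on `L²(D)` that is the evaluation at `z` on holomorphic functions. -/
def evalLp (D : Set (Cn n)) (z : Cn n) : Lp ℂ 2 (volume.restrict D) →L[ℂ] ℂ :=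
  if h : ∃ r > 0, Metric.closedBall z r ⊆ D then ballMean D z h.choose else 0

theorem evalLp_eq (hD : IsOpen D) {z : Cn n} (hz : z ∈ D) {F : Lp ℂ 2 (volume.restrict D)}
    {f : Cn n → ℂ} (hf : DifferentiableOn ℂ f D) (hFf : F =ᵐ[volume.restrict D] f) :
    evalLp D z F = f z := by
  have h := exists_closedBall_subset hD hz
  rw [evalLp, dif_pos h]
  exact ballMean_eq hD h.choose_spec.1 h.choose_spec.2 hf hFf

/-- The mean value bound makes $L^2$-convergence locally uniform, so the limit has a holomorphic
candidate; an almost everywhere convergent subsequence identifies it with the $L^2$ limit. -/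
theorem isClosed_bergmanSubmodule (hD : IsOpen D) :
    IsClosed (bergmanSubmodule D : Set (Lp ℂ 2 (volume.restrict D))) := by
  refine IsSeqClosed.isClosed fun G F hG hlim => ?_
  choose g hg hGg using hG
  have hpt : ∀ z ∈ D, Tendsto (fun m => g m z) atTop (𝓝 (evalLp D z F)) := fun z hz => by
    have h := ((evalLp D z).continuous.tendsto F).comp hlim
    exact h.congr fun m => evalLp_eq hD hz (hg m) (hGg m)
  refine ⟨fun z => evalLp D z F, fun z₀ hz₀ => ?_, ?_⟩
  · obtain ⟨r, hr, hrD, hball⟩ := exists_closedBall_subset_of_ball hD hz₀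
    have hcauchy : UniformCauchySeqOn g atTop (Metric.ball z₀ r) := by
      rw [Metric.uniformCauchySeqOn_iff]
      intro ε hε
      have hB := ballMeanBound_nonneg n r
      obtain ⟨N, hN⟩ := Metric.cauchySeq_iff.1 hlim.cauchySeq
        (ε / (ballMeanBound n r + 1)) (by positivity)
      refine ⟨N, fun i hi j hj z hz => ?_⟩
      have h1 := norm_apply_le_ballMeanBound hD hr (hball z hz) ((hg i).sub (hg j))
        ((Lp.coeFn_sub (G i) (G j)).trans ((hGg i).sub (hGg j)))
      have h2 := hN i hi j hj
      rw [dist_eq_norm] at h2 ⊢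
      rw [lt_div_iff₀ (by positivity)] at h2
      simp only [Pi.sub_apply] at h1
      nlinarith [norm_nonneg (G i - G j)]
    have h := TendstoUniformlyOn.differentiableOn_complex Metric.isOpen_ball
      (hcauchy.tendstoUniformlyOn_of_tendsto fun z hz => hpt z (hrD hz))
      fun m => (hg m).mono hrD
    exact (h.differentiableAt (Metric.ball_mem_nhds _ hr)).differentiableWithinAt
  · obtain ⟨φ, hφ, hae⟩ := (tendstoInMeasure_of_tendsto_Lp hlim).exists_seq_tendsto_ae
    filter_upwards [hae, ae_all_iff.2 hGg, ae_restrict_mem hD.measurableSet] with z h1 h2 h3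
    refine tendsto_nhds_unique h1 (((hpt z h3).comp hφ.tendsto_atTop).congr fun m => ?_)
    simp [h2]

/-- The evaluation at `z` on the Bergman space. -/
def bergmanEval (D : Set (Cn n)) (z : Cn n) : bergmanSubmodule D →L[ℂ] ℂ :=
  evalLp D z ∘L (bergmanSubmodule D).subtypeL

theorem exists_bergmanEval_eq (hD : IsOpen D) (F : bergmanSubmodule D) :
    ∃ f : Cn n → ℂ, DifferentiableOn ℂ f D ∧
      (F : Lp ℂ 2 (volume.restrict D)) =ᵐ[volume.restrict D] f ∧
      ∀ z ∈ D, bergmanEval D z F = f z := by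
  obtain ⟨f, hf, hFf⟩ := F.2
  exact ⟨f, hf, hFf, fun z hz => evalLp_eq hD hz hf hFf⟩

theorem differentiableOn_bergmanEval_apply (hD : IsOpen D) (F : bergmanSubmodule D) :
    DifferentiableOn ℂ (fun z => bergmanEval D z F) D := by
  obtain ⟨f, hf, -, h⟩ := exists_bergmanEval_eq hD F
  exact hf.congr h

theorem bergmanEval_ae_eq (hD : IsOpen D) (F : bergmanSubmodule D) :
    (F : Lp ℂ 2 (volume.restrict D)) =ᵐ[volume.restrict D] fun z => bergmanEval D z F := by
  obtain ⟨f, hf, hFf, h⟩ := exists_bergmanEval_eq hD F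
  filter_upwards [hFf, ae_restrict_mem hD.measurableSet] with z h1 h2
  rw [h1, h z h2]

theorem norm_bergmanEval_le (hD : IsOpen D) {z : Cn n} {r : ℝ} (hr : 0 < r)
    (hz : Metric.closedBall z r ⊆ D) : ‖bergmanEval D z‖ ≤ ballMeanBound n r := by
  refine ContinuousLinearMap.opNorm_le_bound _ (ballMeanBound_nonneg n r) fun F => ?_
  exact norm_apply_le_ballMeanBound hD hr hz (differentiableOn_bergmanEval_apply hD F)
    (bergmanEval_ae_eq hD F)

/-- The evaluation functional depends holomorphically on the point. -/
theorem differentiableOn_bergmanEval (hD : IsOpen D) :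
    DifferentiableOn ℂ (bergmanEval D) D := by
  refine differentiableOn_of_forall_apply (differentiableOn_bergmanEval_apply hD) fun z hz => ?_
  obtain ⟨r, hr, hrD, hball⟩ := exists_closedBall_subset_of_ball hD hz
  exact ⟨r, hr, ballMeanBound n r, hrD, fun w hw => norm_bergmanEval_le hD hr (hball w hw)⟩

/-- A function in `bergmanSpace D` as an element of `bergmanSubmodule D`. -/
def toBergmanSubmodule {f : Cn n → ℂ} (hf : f ∈ bergmanSpace D) : bergmanSubmodule D :=
  ⟨hf.2.toLp f, f, hf.1, hf.2.coeFn_toLp⟩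

theorem bergmanEval_toBergmanSubmodule (hD : IsOpen D) {f : Cn n → ℂ} (hf : f ∈ bergmanSpace D)
    {z : Cn n} (hz : z ∈ D) : bergmanEval D z (toBergmanSubmodule hf) = f z :=
  evalLp_eq hD hz hf.1 hf.2.coeFn_toLp

theorem bergmanEval_mem_bergmanSpace (hD : IsOpen D) (F : bergmanSubmodule D) :
    (fun z => bergmanEval D z F) ∈ bergmanSpace D :=
  ⟨differentiableOn_bergmanEval_apply hD F,
    (memLp_congr_ae (bergmanEval_ae_eq hD F)).1 (Lp.memLp _)⟩

theorem inner_toBergmanSubmodule {f g : Cn n → ℂ} (hf : f ∈ bergmanSpace D)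
    (hg : g ∈ bergmanSpace D) :
    inner ℂ (toBergmanSubmodule hg) (toBergmanSubmodule hf) =
      ∫ z in D, f z * (starRingEnd ℂ) (g z) := by
  change inner ℂ (hg.2.toLp g) (hf.2.toLp f) = _
  rw [L2.inner_def]
  refine integral_congr_ae ?_
  filter_upwards [hf.2.coeFn_toLp, hg.2.coeFn_toLp] with z h1 h2
  rw [h1, h2]
  rfl

theorem toBergmanSubmodule_bergmanEval (hD : IsOpen D) (F : bergmanSubmodule D) :
    toBergmanSubmodule (bergmanEval_mem_bergmanSpace hD F) = F := by
  refine Subtype.ext (Lp.ext ?_)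
  exact (bergmanEval_mem_bergmanSpace hD F).2.coeFn_toLp.trans (bergmanEval_ae_eq hD F).symm

/-- The element of the Bergman space representing the evaluation at `w`. -/
def bergmanVec (D : Set (Cn n)) [CompleteSpace (bergmanSubmodule D)] (w : Cn n) :
    bergmanSubmodule D :=
  (InnerProductSpace.toDual ℂ (bergmanSubmodule D)).symm (bergmanEval D w)

/-! ### Riesz representatives of evaluations and the kernel on the diagonal -/

section

variable [CompleteSpace (bergmanSubmodule D)]

theorem inner_bergmanVec (w : Cn n) (F : bergmanSubmodule D) :
    inner ℂ (bergmanVec D w) F = bergmanEval D w F :=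
  InnerProductSpace.toDual_symm_apply

theorem norm_bergmanVec (w : Cn n) : ‖bergmanVec D w‖ = ‖bergmanEval D w‖ :=
  LinearIsometryEquiv.norm_map _ _

theorem isReproducingAt_bergmanVec (hD : IsOpen D) {w : Cn n} (hw : w ∈ D) :
    IsReproducingAt D w fun z => bergmanEval D z (bergmanVec D w) := by
  refine ⟨bergmanEval_mem_bergmanSpace hD _, fun f hf => ?_⟩
  rw [← inner_toBergmanSubmodule hf (bergmanEval_mem_bergmanSpace hD _),
    toBergmanSubmodule_bergmanEval hD, inner_bergmanVec, bergmanEval_toBergmanSubmodule hD hf hw]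

/-- The kernel is defined by a choice, but any two representing elements have the same inner product
with every element of the space, so they agree on `D`. -/
theorem bergmanKernel_eq (hD : IsOpen D) {z w : Cn n} (hz : z ∈ D) (hw : w ∈ D) :
    bergmanKernel D z w = bergmanEval D z (bergmanVec D w) := by
  have h : ∃ k, IsReproducingAt D w k := ⟨_, isReproducingAt_bergmanVec hD hw⟩
  rw [bergmanKernel, dif_pos h, ← bergmanEval_toBergmanSubmodule hD h.choose_spec.mem hz]
  congr 1
  refine ext_inner_right ℂ fun F => ?_
  rw [inner_bergmanVec, h.choose_spec.reproducing _ (bergmanEval_mem_bergmanSpace hD F),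
    ← inner_toBergmanSubmodule (bergmanEval_mem_bergmanSpace hD F) h.choose_spec.mem,
    toBergmanSubmodule_bergmanEval hD]

theorem bergmanKernel_self_re (hD : IsOpen D) {z : Cn n} (hz : z ∈ D) :
    (bergmanKernel D z z).re = ‖bergmanVec D z‖ ^ 2 := by
  rw [bergmanKernel_eq hD hz hz, ← inner_bergmanVec]
  exact inner_self_eq_norm_sq (𝕜 := ℂ) (bergmanVec D z)

end

/-- A bounded holomorphic function times an element of the Bergman space. -/
theorem mul_mem_bergmanSpace (hD : IsOpen D) {f g : Cn n → ℂ} {C : ℝ}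
    (hg : DifferentiableOn ℂ g D) (hC : ∀ z ∈ D, ‖g z‖ ≤ C) (hf : f ∈ bergmanSpace D) :
    (fun z => g z * f z) ∈ bergmanSpace D := by
  refine ⟨hg.mul hf.1, hf.2.of_le_mul (c := C) ?_ ?_⟩
  · exact (hg.continuousOn.aestronglyMeasurable hD.measurableSet).mul hf.2.1
  · filter_upwards [ae_restrict_mem hD.measurableSet] with z hz
    rw [norm_mul]
    exact mul_le_mul_of_nonneg_right (hC z hz) (norm_nonneg _)

theorem norm_toBergmanSubmodule_mul_le (hD : IsOpen D) {f g : Cn n → ℂ} {C : ℝ}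
    (hC : ∀ z ∈ D, ‖g z‖ ≤ C) (hf : f ∈ bergmanSpace D)
    (hgf : (fun z => g z * f z) ∈ bergmanSpace D) :
    ‖toBergmanSubmodule hgf‖ ≤ C * ‖toBergmanSubmodule hf‖ := by
  change ‖hgf.2.toLp _‖ ≤ C * ‖hf.2.toLp f‖
  refine Lp.norm_le_mul_norm_of_ae_le_mul ?_
  filter_upwards [ae_restrict_mem hD.measurableSet, hgf.2.coeFn_toLp, hf.2.coeFn_toLp]
    with z hz h1 h2
  rw [h1, h2, norm_mul]
  exact mul_le_mul_of_nonneg_right (hC z hz) (norm_nonneg _)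

theorem one_mem_bergmanSpace (hb : Bornology.IsBounded D) :
    (fun _ => 1 : Cn n → ℂ) ∈ bergmanSpace D := by
  have : IsFiniteMeasure (volume.restrict D) := ⟨by
    rw [Measure.restrict_apply_univ]
    exact hb.measure_lt_top⟩
  exact ⟨differentiableOn_const _, memLp_const _⟩

/-- Ensures $K(z,z)>0$, so that $\log K(z,z)$ can be differentiated. -/
theorem bergmanEval_ne_zero (hD : IsOpen D) (hb : Bornology.IsBounded D) {z : Cn n} (hz : z ∈ D) :
    bergmanEval D z ≠ 0 := fun h => by
  have h1 := bergmanEval_toBergmanSubmodule hD (one_mem_bergmanSpace hb) hz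
  rw [h] at h1
  simp at h1

end BergmanSpace

/-! ### The Levi form of the logarithm of the norm of a holomorphic map to a dual space -/

theorem fderiv_apply_const {n : ℕ} {V : Type*} [NormedAddCommGroup V]
    [NormedSpace ℂ V] {T : Cn n → V →L[ℂ] ℂ} {z : Cn n} (hT : DifferentiableAt ℂ T z) (F : V)
    (v : Cn n) :
    fderiv ℂ (fun ζ => T ζ F) z v = fderiv ℂ T z v F := by
  have h := hT.hasFDerivAt.clm_apply (hasFDerivAt_const F z)
  rw [h.fderiv]
  simp

section Levi

variable {n : ℕ} {D : Set (Cn n)} {H : Type*} [NormedAddCommGroup H] [InnerProductSpace ℂ H]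
  [CompleteSpace H]

/-- The Riesz isomorphism as a continuous real linear map. -/
def riesz (H : Type*) [NormedAddCommGroup H] [InnerProductSpace ℂ H]
    [CompleteSpace H] : (H →L[ℂ] ℂ) →L[ℝ] H where
  toFun := (InnerProductSpace.toDual ℂ H).symm
  map_add' := map_add _
  map_smul' c x := by
    change (InnerProductSpace.toDual ℂ H).symm ((c : ℂ) • x) = (c : ℂ) • _
    rw [map_smulₛₗ, Complex.conj_ofReal]
  cont := (InnerProductSpace.toDual ℂ H).symm.continuous

theorem riesz_smul (c : ℂ) (x : H →L[ℂ] ℂ) : riesz H (c • x) = (starRingEnd ℂ) c • riesz H x :=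
  map_smulₛₗ (InnerProductSpace.toDual ℂ H).symm c x

theorem norm_riesz (x : H →L[ℂ] ℂ) : ‖riesz H x‖ = ‖x‖ :=
  (InnerProductSpace.toDual ℂ H).symm.norm_map x

theorem inner_riesz (x : H →L[ℂ] ℂ) (F : H) : inner ℂ (riesz H x) F = x F :=
  InnerProductSpace.toDual_symm_apply

variable {T : Cn n → H →L[ℂ] ℂ}

/-- The derivative of the vector representing `T z` in the direction `v`. -/
def rieszDeriv (T : Cn n → H →L[ℂ] ℂ) (z v : Cn n) : H := riesz H (fderiv ℂ T z v)

theorem rieszDeriv_smul (z v : Cn n) (c : ℂ) :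
    rieszDeriv T z (c • v) = (starRingEnd ℂ) c • rieszDeriv T z v := by
  simp only [rieszDeriv, map_smul, riesz_smul]

theorem rieszDeriv_eq_sum (z v : Cn n) :
    rieszDeriv T z v = ∑ j, (starRingEnd ℂ) (v j) •
      rieszDeriv T z (EuclideanSpace.single j 1) := by
  have hv : v = ∑ j, v j • EuclideanSpace.single j (1 : ℂ) := by
    ext i
    simp [Pi.single_apply]
  conv_lhs => rw [hv]
  simp only [rieszDeriv, map_sum, map_smul, riesz_smul]

theorem single_I (j : Fin n) :
    EuclideanSpace.single j Complex.I = Complex.I • EuclideanSpace.single j (1 : ℂ) := by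
  ext i
  simp

/-- A holomorphic map to the dual space becomes real differentiable after the Riesz isomorphism. -/
theorem hasFDerivAt_riesz {z : Cn n} (hT : DifferentiableAt ℂ T z) :
    HasFDerivAt (𝕜 := ℝ) (fun ζ => riesz H (T ζ))
      (riesz H ∘L (fderiv ℂ T z).restrictScalars ℝ) z :=
  (riesz H).hasFDerivAt.comp z (hT.hasFDerivAt.restrictScalars ℝ)

theorem hasFDerivAt_norm_sq {z : Cn n} (hT : DifferentiableAt ℂ T z) :
    ∃ L : Cn n →L[ℝ] ℝ, HasFDerivAt (fun ζ => ‖T ζ‖ ^ 2) L z ∧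
      ∀ v, L v = 2 * (inner ℂ (riesz H (T z)) (rieszDeriv T z v)).re := by
  have h := (hasFDerivAt_riesz hT).inner ℂ (hasFDerivAt_riesz hT)
  have h2 := Complex.reCLM.hasFDerivAt.comp z h
  have h3 : (fun ζ => ‖T ζ‖ ^ 2) =
      Complex.reCLM ∘ fun ζ => inner ℂ (riesz H (T ζ)) (riesz H (T ζ)) := by
    ext ζ
    rw [← norm_riesz]
    exact (inner_self_eq_norm_sq (𝕜 := ℂ) _).symm
  rw [h3]
  refine ⟨_, h2, fun v => ?_⟩
  have h4 : (inner ℂ (rieszDeriv T z v) (riesz H (T z))).re =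
      (inner ℂ (riesz H (T z)) (rieszDeriv T z v)).re := by
    rw [← inner_conj_symm, Complex.conj_re]
  change (inner ℂ (riesz H (T z)) (rieszDeriv T z v) +
    inner ℂ (rieszDeriv T z v) (riesz H (T z))).re = _
  rw [Complex.add_re, h4]
  ring

/-- The Riesz vector is antiholomorphic: direction `I • e` multiplies its derivative by `-I`. Hence
the two real derivatives contribute the real and imaginary parts of a single inner product. -/
theorem wirtingerBar_log_norm_sq {z : Cn n} (hT : DifferentiableAt ℂ T z) (hT0 : T z ≠ 0)
    (k : Fin n) :
    wirtingerBar k (fun ζ => ((Real.log (‖T ζ‖ ^ 2) : ℝ) : ℂ)) z =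
      inner ℂ (riesz H (T z)) (rieszDeriv T z (EuclideanSpace.single k 1)) *
        (((‖T z‖ ^ 2)⁻¹ : ℝ) : ℂ) := by
  obtain ⟨L, hL, hLv⟩ := hasFDerivAt_norm_sq hT
  have hlog := Complex.ofRealCLM.hasFDerivAt.comp z
    (hL.log (pow_ne_zero 2 (norm_ne_zero_iff.2 hT0)))
  have hval : ∀ v, fderiv ℝ (fun ζ => ((Real.log (‖T ζ‖ ^ 2) : ℝ) : ℂ)) z v =
      (((‖T z‖ ^ 2)⁻¹ * (2 * (inner ℂ (riesz H (T z)) (rieszDeriv T z v)).re) : ℝ) : ℂ) :=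
    fun v => by
      rw [← hLv]
      exact DFunLike.congr_fun hlog.fderiv v
  rw [wirtingerBar, hval, hval, single_I, rieszDeriv_smul, inner_smul_right]
  generalize inner ℂ (riesz H (T z)) (rieszDeriv T z (EuclideanSpace.single k 1)) = w
  generalize (‖T z‖ ^ 2)⁻¹ = N
  apply Complex.ext
  · simp
    ring
  · simp
    ring

theorem wirtinger_congr {j : Fin n} {φ ψ : Cn n → ℂ} {z : Cn n} (h : φ =ᶠ[𝓝 z] ψ) :
    wirtinger j φ z = wirtinger j ψ z := by
  simp only [wirtinger, h.fderiv_eq]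

theorem wirtingerBar_congr {j : Fin n} {φ ψ : Cn n → ℂ} {z : Cn n} (h : φ =ᶠ[𝓝 z] ψ) :
    wirtingerBar j φ z = wirtingerBar j ψ z := by
  simp only [wirtingerBar, h.fderiv_eq]

/-- By antiholomorphy the term containing a second derivative of `T` cancels in $\partial/\partial
z_j$; only the product of first derivatives and the derivative of `(‖T‖ ^ 2)⁻¹` remain. -/
theorem wirtinger_wirtingerBar_log_norm_sq (hD : IsOpen D) (hT : DifferentiableOn ℂ T D)
    (hT0 : ∀ z ∈ D, T z ≠ 0) (j k : Fin n) {z : Cn n} (hz : z ∈ D) :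
    wirtinger j (wirtingerBar k fun ζ => ((Real.log (‖T ζ‖ ^ 2) : ℝ) : ℂ)) z =
      inner ℂ (rieszDeriv T z (EuclideanSpace.single j 1))
        (rieszDeriv T z (EuclideanSpace.single k 1)) * (((‖T z‖ ^ 2)⁻¹ : ℝ) : ℂ) -
      inner ℂ (riesz H (T z)) (rieszDeriv T z (EuclideanSpace.single k 1)) *
        inner ℂ (rieszDeriv T z (EuclideanSpace.single j 1)) (riesz H (T z)) *
        ((((‖T z‖ ^ 2)⁻¹ : ℝ) : ℂ)) ^ 2 := by
  set ek : Cn n := EuclideanSpace.single k 1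
  set ej : Cn n := EuclideanSpace.single j 1
  have hTz : ∀ ζ ∈ D, DifferentiableAt ℂ T ζ := fun ζ hζ => hT.differentiableAt (hD.mem_nhds hζ)
  obtain ⟨L, hL, hLv⟩ := hasFDerivAt_norm_sq (hTz z hz)
  have heq : (wirtingerBar k fun ζ => ((Real.log (‖T ζ‖ ^ 2) : ℝ) : ℂ)) =ᶠ[𝓝 z]
      fun ζ => inner ℂ (riesz H (T ζ)) (rieszDeriv T ζ ek) *
        Complex.ofRealCLM ((‖T ζ‖ ^ 2)⁻¹) := by
    filter_upwards [hD.mem_nhds hz] with ζ hζ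
    exact wirtingerBar_log_norm_sq (hTz ζ hζ) (hT0 ζ hζ) k
  have hT' : DifferentiableAt ℂ (fun ζ => fderiv ℂ T ζ ek) z :=
    (hT.fderiv_apply_complex hD ek).differentiableAt (hD.mem_nhds hz)
  have h1 := (hasFDerivAt_riesz (hTz z hz)).inner ℂ (hasFDerivAt_riesz hT')
  have h2 := Complex.ofRealCLM.hasFDerivAt.comp z
    ((hasDerivAt_inv (pow_ne_zero 2 (norm_ne_zero_iff.2 (hT0 z hz)))).hasFDerivAt.comp z hL)
  have h3 := (h1.mul h2).fderiv
  rw [wirtinger_congr heq]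
  have hval : ∀ v, fderiv ℝ (fun ζ => inner ℂ (riesz H (T ζ)) (rieszDeriv T ζ ek) *
        Complex.ofRealCLM ((‖T ζ‖ ^ 2)⁻¹)) z v =
      inner ℂ (riesz H (T z)) (rieszDeriv T z ek) *
        (((2 * (inner ℂ (riesz H (T z)) (rieszDeriv T z v)).re *
          -((‖T z‖ ^ 2) ^ 2)⁻¹) : ℝ) : ℂ) +
      (((‖T z‖ ^ 2)⁻¹ : ℝ) : ℂ) * (inner ℂ (riesz H (T z))
          (rieszDeriv (fun ζ => fderiv ℂ T ζ ek) z v) +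
        inner ℂ (rieszDeriv T z v) (rieszDeriv T z ek)) := fun v => by
    rw [← hLv]
    exact DFunLike.congr_fun h3 v
  rw [wirtinger, hval, hval, single_I]
  simp only [rieszDeriv_smul, Complex.conj_I, inner_smul_right, inner_smul_left,
    ← inner_conj_symm (rieszDeriv T z ej) (riesz H (T z)), map_neg, neg_neg, neg_mul, ej]
  generalize inner ℂ (riesz H (T z)) (rieszDeriv T z (EuclideanSpace.single j 1)) = w
  generalize inner ℂ (riesz H (T z)) (rieszDeriv T z ek) = w'
  generalize inner ℂ (rieszDeriv T z (EuclideanSpace.single j 1)) (rieszDeriv T z ek) = g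
  generalize inner ℂ (riesz H (T z)) (rieszDeriv (fun ζ => fderiv ℂ T ζ ek) z
    (EuclideanSpace.single j 1)) = s
  rw [← inv_pow]
  generalize (‖T z‖ ^ 2)⁻¹ = N
  have hw : (((w.re : ℝ) : ℂ)) - Complex.I * ((w.im : ℝ) : ℂ) = (starRingEnd ℂ) w := by
    apply Complex.ext <;> simp
  rw [← hw]
  have hre : (-(Complex.I * w)).re = w.im := by simp
  rw [hre]
  push_cast
  linear_combination (-(1 / 2 : ℂ) * N * (g - s)) * Complex.I_sq

/-- The Levi form of `log ‖T‖²`. -/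
theorem levi_log_norm_sq (hD : IsOpen D) (hT : DifferentiableOn ℂ T D)
    (hT0 : ∀ z ∈ D, T z ≠ 0) {z : Cn n} (hz : z ∈ D) (v : Cn n) :
    (∑ j, ∑ k, wirtinger j (wirtingerBar k fun ζ => ((Real.log (‖T ζ‖ ^ 2) : ℝ) : ℂ)) z * v j *
        (starRingEnd ℂ) (v k)).re =
      ‖rieszDeriv T z v‖ ^ 2 / ‖T z‖ ^ 2 -
        ‖inner ℂ (riesz H (T z)) (rieszDeriv T z v)‖ ^ 2 / (‖T z‖ ^ 2) ^ 2 := by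
  have hA : (∑ j, ∑ k, inner ℂ (rieszDeriv T z (EuclideanSpace.single j 1))
        (rieszDeriv T z (EuclideanSpace.single k 1)) * v j * (starRingEnd ℂ) (v k)) =
      inner ℂ (rieszDeriv T z v) (rieszDeriv T z v) := by
    rw [rieszDeriv_eq_sum z v, sum_inner]
    refine Finset.sum_congr rfl fun j _ => ?_
    rw [inner_sum]
    refine Finset.sum_congr rfl fun k _ => ?_
    rw [inner_smul_left, inner_smul_right, Complex.conj_conj]
    ring
  have hB : ∑ k, inner ℂ (riesz H (T z)) (rieszDeriv T z (EuclideanSpace.single k 1)) *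
      (starRingEnd ℂ) (v k) = inner ℂ (riesz H (T z)) (rieszDeriv T z v) := by
    rw [rieszDeriv_eq_sum z v, inner_sum]
    refine Finset.sum_congr rfl fun k _ => ?_
    rw [inner_smul_right, mul_comm]
  have hC : ∑ j, inner ℂ (rieszDeriv T z (EuclideanSpace.single j 1)) (riesz H (T z)) * v j =
      inner ℂ (rieszDeriv T z v) (riesz H (T z)) := by
    rw [rieszDeriv_eq_sum z v, sum_inner]
    refine Finset.sum_congr rfl fun k _ => ?_
    rw [inner_smul_left, mul_comm, Complex.conj_conj]
  have key : (∑ j, ∑ k, wirtinger j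
      (wirtingerBar k fun ζ => ((Real.log (‖T ζ‖ ^ 2) : ℝ) : ℂ)) z * v j *
        (starRingEnd ℂ) (v k)) =
      inner ℂ (rieszDeriv T z v) (rieszDeriv T z v) * (((‖T z‖ ^ 2)⁻¹ : ℝ) : ℂ) -
      inner ℂ (rieszDeriv T z v) (riesz H (T z)) *
        inner ℂ (riesz H (T z)) (rieszDeriv T z v) * ((((‖T z‖ ^ 2)⁻¹ : ℝ) : ℂ)) ^ 2 := by
    rw [← hA, ← hB, ← hC, Finset.sum_mul_sum]
    simp only [Finset.sum_mul, ← Finset.sum_sub_distrib]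
    refine Finset.sum_congr rfl fun j _ => Finset.sum_congr rfl fun k _ => ?_
    rw [wirtinger_wirtingerBar_log_norm_sq hD hT hT0 j k hz]
    ring
  rw [key, ← inner_conj_symm (rieszDeriv T z v) (riesz H (T z)), ← Complex.normSq_eq_conj_mul_self,
    inner_self_eq_norm_sq_to_K, Complex.normSq_eq_norm_sq]
  generalize ‖inner ℂ (riesz H (T z)) (rieszDeriv T z v)‖ = x
  have : ∀ a b c : ℝ, ((a : ℂ) ^ 2 * (c : ℂ) - ((b : ℝ) : ℂ) * (c : ℂ) ^ 2).re =
      a ^ 2 * c - b * c ^ 2 := fun a b c => by norm_cast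
  refine (this _ _ _).trans ?_
  rw [inv_pow, div_eq_mul_inv, div_eq_mul_inv]
  rfl

/-- An estimate of the Levi form of `log ‖T‖²` from below. -/
theorem norm_apply_sq_le_levi {z : Cn n} {F : H} (hF : T z F = 0) (hT0 : T z ≠ 0) (v : Cn n) :
    ‖fderiv ℂ T z v F‖ ^ 2 ≤ (‖rieszDeriv T z v‖ ^ 2 -
        ‖inner ℂ (riesz H (T z)) (rieszDeriv T z v)‖ ^ 2 / ‖T z‖ ^ 2) * ‖F‖ ^ 2 := by
  set k := riesz H (T z)
  set w := rieszDeriv T z v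
  have hk : ‖k‖ = ‖T z‖ := norm_riesz _
  have hkpos : 0 < ‖k‖ := by rw [hk]; exact norm_pos_iff.2 hT0
  -- `c • k` is the projection of `w` onto `k`. Since `F` is orthogonal to `k`, only `w - c • k`
  -- pairs with `F`, and Cauchy–Schwarz finishes.
  set c : ℂ := inner ℂ k w * ((‖k‖ ^ 2 : ℝ) : ℂ)⁻¹
  have hkF : inner ℂ k F = 0 := by rw [inner_riesz, hF]
  have h1 : fderiv ℂ T z v F = inner ℂ (w - c • k) F := by
    rw [inner_sub_left, inner_smul_left, hkF, mul_zero, sub_zero]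
    exact (inner_riesz _ _).symm
  have hkk : inner ℂ k k = ((‖k‖ ^ 2 : ℝ) : ℂ) := by
    rw [inner_self_eq_norm_sq_to_K]; norm_cast
  have hne : ((‖k‖ ^ 2 : ℝ) : ℂ) ≠ 0 := by
    exact_mod_cast (pow_pos hkpos 2).ne'
  have horth : inner ℂ (c • k) (w - c • k) = 0 := by
    rw [inner_smul_left, inner_sub_right, inner_smul_right, hkk, inv_mul_cancel_right₀ hne,
      sub_self, mul_zero]
  have h2 : ‖w‖ ^ 2 = ‖c • k‖ ^ 2 + ‖w - c • k‖ ^ 2 := by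
    have := norm_add_sq_eq_norm_sq_add_norm_sq_of_inner_eq_zero _ _ horth
    rw [add_sub_cancel] at this
    simpa only [sq] using this
  have h3 : ‖c • k‖ ^ 2 = ‖inner ℂ k w‖ ^ 2 / ‖k‖ ^ 2 := by
    rw [norm_smul, norm_mul, norm_inv, Complex.norm_real, Real.norm_of_nonneg (by positivity)]
    field_simp
  rw [h1, ← hk, ← h3, h2, add_sub_cancel_left, ← mul_pow]
  exact pow_le_pow_left₀ (norm_nonneg _) (norm_inner_le_norm _ _) 2

theorem norm_le_two_mul_sqrt_levi {z : Cn n} {F : H} (hF : T z F = 0) (hT0 : T z ≠ 0) {v : Cn n}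
    {x : ℂ} (hx : fderiv ℂ T z v F = x * ((‖T z‖ ^ 2 : ℝ) : ℂ)) (hFT : ‖F‖ ≤ 2 * ‖T z‖) :
    ‖x‖ ≤ 2 * √(‖rieszDeriv T z v‖ ^ 2 / ‖T z‖ ^ 2 -
        ‖inner ℂ (riesz H (T z)) (rieszDeriv T z v)‖ ^ 2 / (‖T z‖ ^ 2) ^ 2) := by
  have key := norm_apply_sq_le_levi hF hT0 v
  have ht : 0 < ‖T z‖ := norm_pos_iff.2 hT0
  rw [hx, norm_mul, Complex.norm_real, Real.norm_of_nonneg (by positivity)] at key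
  generalize ‖inner ℂ (riesz H (T z)) (rieszDeriv T z v)‖ = b at *
  generalize ‖rieszDeriv T z v‖ = a at *
  generalize ‖T z‖ = t at *
  rcases (norm_nonneg x).eq_or_lt with h0 | h0
  · rw [← h0]
    positivity
  generalize ‖x‖ = r at *
  have hA : a ^ 2 / t ^ 2 - b ^ 2 / (t ^ 2) ^ 2 = (a ^ 2 - b ^ 2 / t ^ 2) / t ^ 2 := by
    field_simp
  rw [hA]
  generalize a ^ 2 - b ^ 2 / t ^ 2 = A at *
  -- Positivity is forced by `key` when `x ≠ 0`; it is needed to replace `‖F‖` by its upper bound.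
  have hApos : 0 < A := by
    by_contra h
    have h1 : 0 < (r * t ^ 2) ^ 2 := by positivity
    nlinarith [sq_nonneg ‖F‖]
  have h2 : ‖F‖ ^ 2 ≤ (2 * t) ^ 2 := pow_le_pow_left₀ (norm_nonneg F) hFT 2
  have h3 : (r * t ^ 2) ^ 2 ≤ A * (2 * t) ^ 2 :=
    key.trans (mul_le_mul_of_nonneg_left h2 hApos.le)
  have h4 : (r / 2) ^ 2 ≤ A / t ^ 2 := by
    rw [le_div_iff₀ (by positivity)]
    have h5 : 0 < t ^ 2 := by positivity
    refine le_of_mul_le_mul_right ?_ h5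
    linarith [show (r / 2) ^ 2 * t ^ 2 * t ^ 2 = (r * t ^ 2) ^ 2 / 4 by ring,
      show A * (2 * t) ^ 2 / 4 = A * t ^ 2 by ring]
  linarith [Real.le_sqrt_of_sq_le h4]

theorem sqrt_levi_le {z v : Cn n} {m M : ℝ} (hm : 0 < m) (hTm : m ≤ ‖T z‖)
    (hM : ‖fderiv ℂ T z‖ ≤ M) :
    √(‖rieszDeriv T z v‖ ^ 2 / ‖T z‖ ^ 2 -
        ‖inner ℂ (riesz H (T z)) (rieszDeriv T z v)‖ ^ 2 / (‖T z‖ ^ 2) ^ 2) ≤ M / m * ‖v‖ := by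
  have hM0 : 0 ≤ M := (norm_nonneg (fderiv ℂ T z)).trans hM
  refine Real.sqrt_le_iff.2 ⟨by positivity, (sub_le_self _ (by positivity)).trans ?_⟩
  rw [← div_pow, rieszDeriv, norm_riesz]
  refine pow_le_pow_left₀ (by positivity) ?_ 2
  calc _ ≤ (M * ‖v‖) / m := by
        gcongr
        exact (fderiv ℂ T z).le_of_opNorm_le hM v
    _ = _ := by ring

theorem exists_sqrt_levi_le (hD : IsOpen D) (hT : DifferentiableOn ℂ T D) {x : Cn n} (hx : x ∈ D)
    (hT0 : T x ≠ 0) : ∃ r > 0, ∃ C ≥ 0, Metric.ball x r ⊆ D ∧ ∀ z ∈ Metric.ball x r, ∀ v,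
      √(‖rieszDeriv T z v‖ ^ 2 / ‖T z‖ ^ 2 -
        ‖inner ℂ (riesz H (T z)) (rieszDeriv T z v)‖ ^ 2 / (‖T z‖ ^ 2) ^ 2) ≤ C * ‖v‖ := by
  have hpos : 0 < ‖T x‖ := norm_pos_iff.2 hT0
  have hcont : ContinuousAt (fun z => ‖T z‖) x :=
    (hT.differentiableAt (hD.mem_nhds hx)).continuousAt.norm
  obtain ⟨ρ, hρ, hρD⟩ := Metric.mem_nhds_iff.1 (inter_mem (hD.mem_nhds hx) (inter_mem
    (hcont.eventually_lt_const (lt_add_one _)) (hcont.eventually_const_lt (half_lt_self hpos))))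
  obtain ⟨r, hr, rfl⟩ : ∃ r, 0 < r ∧ ρ = r + r := ⟨ρ / 2, by positivity, by ring⟩
  refine ⟨r, hr, 2 * (‖T x‖ + 1) / r / (‖T x‖ / 2), by positivity, ?_, fun z hz v => ?_⟩
  · exact fun z hz => (hρD (Metric.ball_subset_ball (by linarith) hz)).1
  · have hball : Metric.ball z r ⊆ Metric.ball x (r + r) :=
      Metric.ball_subset_ball' (by linarith [Metric.mem_ball.1 hz])
    have hzD := hρD (hball (Metric.mem_ball_self hr))
    exact sqrt_levi_le (half_pos hpos) hzD.2.2.le (norm_fderiv_le_of_norm_le hr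
      (hT.mono fun w hw => (hρD (hball hw)).1) fun w hw => (hρD (hball hw)).2.1.le)

end Levi

/-! ### Estimates of the Bergman metric -/

section BergmanMetric

variable {n : ℕ} {D : Set (Cn n)}

theorem bergmanNorm_eq [CompleteSpace (bergmanSubmodule D)] (hD : IsOpen D)
    (hb : Bornology.IsBounded D) {z : Cn n} (hz : z ∈ D) (v : Cn n) :
    bergmanNorm D z v = √(‖rieszDeriv (bergmanEval D) z v‖ ^ 2 / ‖bergmanEval D z‖ ^ 2 -
        ‖inner ℂ (riesz _ (bergmanEval D z)) (rieszDeriv (bergmanEval D) z v)‖ ^ 2 /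
          (‖bergmanEval D z‖ ^ 2) ^ 2) := by
  rw [bergmanNorm, ← levi_log_norm_sq hD (differentiableOn_bergmanEval hD)
    (fun z hz => bergmanEval_ne_zero hD hb hz) hz v]
  have heq : (fun ζ => ((Real.log (bergmanKernel D ζ ζ).re : ℝ) : ℂ)) =ᶠ[𝓝 z]
      fun ζ => ((Real.log (‖bergmanEval D ζ‖ ^ 2) : ℝ) : ℂ) := by
    filter_upwards [hD.mem_nhds hz] with ζ hζ
    rw [bergmanKernel_self_re hD hζ, norm_bergmanVec]
  have hcoeff : ∀ j k, bergmanCoeff D j k z = wirtinger j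
      (wirtingerBar k fun ζ => ((Real.log (‖bergmanEval D ζ‖ ^ 2) : ℝ) : ℂ)) z := fun j k =>
    wirtinger_congr (heq.eventually_nhds.mono fun _ => wirtingerBar_congr)
  simp only [hcoeff]

theorem bergmanNorm_smul (z v : Cn n) (s : ℝ) :
    bergmanNorm D z (s • v) = |s| * bergmanNorm D z v := by
  have h : (∑ j, ∑ k, bergmanCoeff D j k z * (s • v) j * (starRingEnd ℂ) ((s • v) k)) =
      ((s ^ 2 : ℝ) : ℂ) * ∑ j, ∑ k, bergmanCoeff D j k z * v j * (starRingEnd ℂ) (v k) := by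
    simp only [Finset.mul_sum]
    refine Finset.sum_congr rfl fun j _ => Finset.sum_congr rfl fun k _ => ?_
    simp only [PiLp.smul_apply, Complex.real_smul, map_mul, Complex.conj_ofReal]
    push_cast
    ring
  rw [bergmanNorm, h, Complex.re_ofReal_mul, Real.sqrt_mul (sq_nonneg s), Real.sqrt_sq_eq_abs,
    bergmanNorm]

theorem fderiv_sub_const_mul_apply {φ k : Cn n → ℂ} {z : Cn n} (hφ : DifferentiableAt ℂ φ z)
    (hk : DifferentiableAt ℂ k z) (v : Cn n) :
    fderiv ℂ (fun ζ => (φ ζ - φ z) * k ζ) z v = fderiv ℂ φ z v * k z := by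
  rw [fderiv_fun_mul (hφ.sub_const _) hk, fderiv_sub_const]
  simp [mul_comm]

/-- The witness is $F=(\varphi-\varphi(z))k_z$: the first factor is bounded by 2 and vanishes at
$z$, so the derivative of $F$ there is $d\varphi_z(v)\,k_z(z)$ with $k_z(z)=\|k_z\|^2$. -/
theorem exists_bergmanEval_eq_zero [CompleteSpace (bergmanSubmodule D)] (hD : IsOpen D)
    {φ : Cn n → ℂ} (hφ : DifferentiableOn ℂ φ D) (hφ1 : ∀ z ∈ D, ‖φ z‖ ≤ 1)
    {z : Cn n} (hz : z ∈ D) (v : Cn n) :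
    ∃ F : bergmanSubmodule D, bergmanEval D z F = 0 ∧ ‖F‖ ≤ 2 * ‖bergmanEval D z‖ ∧
      fderiv ℂ (fun ζ => bergmanEval D ζ F) z v =
        fderiv ℂ φ z v * ((‖bergmanEval D z‖ ^ 2 : ℝ) : ℂ) := by
  obtain ⟨k, hk, hkz, hknorm⟩ : ∃ k, ∃ hk : k ∈ bergmanSpace D,
      k z = ((‖bergmanEval D z‖ ^ 2 : ℝ) : ℂ) ∧
        ‖toBergmanSubmodule hk‖ = ‖bergmanEval D z‖ := by
    refine ⟨_, bergmanEval_mem_bergmanSpace hD (bergmanVec D z), ?_, ?_⟩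
    · rw [← norm_bergmanVec, ← inner_bergmanVec, Complex.ofReal_pow]
      exact inner_self_eq_norm_sq_to_K (𝕜 := ℂ) (bergmanVec D z)
    · rw [toBergmanSubmodule_bergmanEval hD, norm_bergmanVec]
  have hg2 : ∀ ζ ∈ D, ‖φ ζ - φ z‖ ≤ 2 := fun ζ hζ =>
    (norm_sub_le _ _).trans (by linarith [hφ1 ζ hζ, hφ1 z hz])
  have hmem : (fun ζ => (φ ζ - φ z) * k ζ) ∈ bergmanSpace D :=
    mul_mem_bergmanSpace hD (hφ.sub_const _) hg2 hk
  have hF : ∀ ζ ∈ D, bergmanEval D ζ (toBergmanSubmodule hmem) = (φ ζ - φ z) * k ζ :=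
    fun ζ hζ => bergmanEval_toBergmanSubmodule hD hmem hζ
  refine ⟨toBergmanSubmodule hmem, ?_, ?_, ?_⟩
  · rw [hF z hz, sub_self, zero_mul]
  · rw [← hknorm]
    exact norm_toBergmanSubmodule_mul_le hD hg2 hk hmem
  · have h : (fun ζ => bergmanEval D ζ (toBergmanSubmodule hmem)) =ᶠ[𝓝 z]
        fun ζ => (φ ζ - φ z) * k ζ := by
      filter_upwards [hD.mem_nhds hz] with ζ hζ using hF ζ hζ
    rw [h.fderiv_eq, ← hkz]
    exact fderiv_sub_const_mul_apply (hφ.differentiableAt (hD.mem_nhds hz))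
      (hk.1.differentiableAt (hD.mem_nhds hz)) v

/-- The Bergman metric dominates the Carathéodory metric up to a constant. -/
theorem norm_fderiv_le_bergmanNorm (hD : IsOpen D) (hb : Bornology.IsBounded D)
    {φ : Cn n → ℂ} (hφ : DifferentiableOn ℂ φ D) (hφ1 : ∀ z ∈ D, ‖φ z‖ ≤ 1)
    {z : Cn n} (hz : z ∈ D) (v : Cn n) : ‖fderiv ℂ φ z v‖ ≤ 2 * bergmanNorm D z v := by
  have : CompleteSpace (bergmanSubmodule D) :=
    (isClosed_bergmanSubmodule hD).completeSpace_coe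
  obtain ⟨F, hF, hFnorm, hder⟩ := exists_bergmanEval_eq_zero hD hφ hφ1 hz v
  rw [fderiv_apply_const ((differentiableOn_bergmanEval hD).differentiableAt (hD.mem_nhds hz))]
    at hder
  rw [bergmanNorm_eq hD hb hz v]
  exact norm_le_two_mul_sqrt_levi hF (bergmanEval_ne_zero hD hb hz) hder hFnorm

theorem exists_bergmanNorm_le (hD : IsOpen D) (hb : Bornology.IsBounded D) {x : Cn n}
    (hx : x ∈ D) : ∃ r > 0, ∃ C ≥ 0, Metric.ball x r ⊆ D ∧
      ∀ z ∈ Metric.ball x r, ∀ v, bergmanNorm D z v ≤ C * ‖v‖ := by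
  have : CompleteSpace (bergmanSubmodule D) :=
    (isClosed_bergmanSubmodule hD).completeSpace_coe
  obtain ⟨r, hr, C, hC, hrD, h⟩ := exists_sqrt_levi_le hD (differentiableOn_bergmanEval hD) hx
    (bergmanEval_ne_zero hD hb hx)
  refine ⟨r, hr, C, hC, hrD, fun z hz v => ?_⟩
  rw [bergmanNorm_eq hD hb (hrD hz) v]
  exact h z hz v

theorem contDiffOn_one_of_differentiableOn (hD : IsOpen D) {φ : Cn n → ℂ}
    (hφ : DifferentiableOn ℂ φ D) : ContDiffOn ℝ 1 φ D := by
  refine ContDiffOn.restrict_scalars ℝ (𝕜' := ℂ) ?_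
  have h := (contDiffOn_succ_iff_fderiv_of_isOpen (𝕜 := ℂ) (n := 0) (f := φ) hD).2
    ⟨hφ, by simp, ?_⟩
  · simpa using h
  · rw [contDiffOn_zero, continuousOn_clm_apply]
    exact fun v => (hφ.fderiv_apply_complex hD v).continuousOn

theorem norm_sub_le_bergmanLength (hD : IsOpen D) (hb : Bornology.IsBounded D)
    {φ : Cn n → ℂ} (hφ : DifferentiableOn ℂ φ D) (hφ1 : ∀ z ∈ D, ‖φ z‖ ≤ 1) {x y : Cn n}
    {γ : ℝ → Cn n} (hγ : IsCurveIn D x y γ) :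
    ENNReal.ofReal ‖φ x - φ y‖ ≤ 2 * bergmanLength D γ := by
  have h := enorm_sub_le_lintegral_derivWithin_Icc_of_contDiffOn_Icc
    ((contDiffOn_one_of_differentiableOn hD hφ).comp hγ.contDiffOn hγ.mapsTo) zero_le_one
  simp only [Function.comp_apply, hγ.start_eq, hγ.end_eq] at h
  rw [norm_sub_rev, ofReal_norm]
  refine h.trans ?_
  rw [bergmanLength, ← lintegral_const_mul' _ _ (by simp)]
  refine setLIntegral_mono' measurableSet_Icc fun t ht => ?_
  have hγt := (hγ.contDiffOn.differentiableOn one_ne_zero t ht).hasDerivWithinAt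
  have hφt := (hφ.differentiableAt (hD.mem_nhds (hγ.mapsTo ht))).hasFDerivAt.restrictScalars ℝ
  have hd : derivWithin (φ ∘ γ) (Icc 0 1) t = fderiv ℂ φ (γ t) (derivWithin γ (Icc 0 1) t) :=
    (hφt.comp_hasDerivWithinAt t hγt).derivWithin (uniqueDiffOn_Icc_zero_one t ht)
  rw [hd, ← ofReal_norm]
  refine (ENNReal.ofReal_le_ofReal
    (norm_fderiv_le_bergmanNorm hD hb hφ hφ1 (hγ.mapsTo ht) _)).trans_eq ?_
  rw [ENNReal.ofReal_mul (by norm_num), ENNReal.ofReal_ofNat]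

/-! ### The Bergman distance -/

/-- The length of a part of a curve `σ` that reparametrizes a part of `γ`. -/
theorem lintegral_bergmanNorm_le_of_reparam {x y : Cn n} {γ σ : ℝ → Cn n}
    (hγ : IsCurveIn D x y γ) {a b : ℝ} (hab : Ioo a b ⊆ Ioo 0 1) {h h' : ℝ → ℝ}
    (hd : ∀ t ∈ Ioo a b, HasDerivAt h (h' t) t) (hinj : InjOn h (Ioo a b))
    (hm : MapsTo h (Ioo a b) (Ioo 0 1)) (hσ : ∀ t ∈ Ioo a b, σ =ᶠ[𝓝 t] γ ∘ h) :
    ∫⁻ t in Ioo a b, ENNReal.ofReal (bergmanNorm D (σ t) (derivWithin σ (Icc 0 1) t)) ≤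
      bergmanLength D γ := by
  have hγd : ∀ s ∈ Ioo (0 : ℝ) 1, HasDerivAt γ (derivWithin γ (Icc 0 1) s) s := fun s hs =>
    (hγ.contDiffOn.differentiableOn one_ne_zero s
      (Ioo_subset_Icc_self hs)).hasDerivWithinAt.hasDerivAt (Icc_mem_nhds hs.1 hs.2)
  calc _ = ∫⁻ t in Ioo a b, ENNReal.ofReal |h' t| *
        ENNReal.ofReal (bergmanNorm D (γ (h t)) (derivWithin γ (Icc 0 1) (h t))) := by
        refine setLIntegral_congr_fun measurableSet_Ioo fun t ht => ?_
        have h1 : HasDerivAt σ (h' t • derivWithin γ (Icc 0 1) (h t)) t :=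
          ((hγd _ (hm ht)).scomp t (hd t ht)).congr_of_eventuallyEq (hσ t ht)
        have h2 : derivWithin σ (Icc 0 1) t = h' t • derivWithin γ (Icc 0 1) (h t) :=
          h1.hasDerivWithinAt.derivWithin
            (uniqueDiffOn_Icc_zero_one t (Ioo_subset_Icc_self (hab ht)))
        rw [h2, (hσ t ht).eq_of_nhds, bergmanNorm_smul, ENNReal.ofReal_mul (abs_nonneg _)]
        rfl
    -- Change of variables for an injective map; the absolute value of the derivative lets it serve
    -- for reversal as well as for concatenation.
    _ = ∫⁻ s in h '' Ioo a b, ENNReal.ofReal (bergmanNorm D (γ s) (derivWithin γ (Icc 0 1) s)) :=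
        (lintegral_image_eq_lintegral_abs_deriv_mul measurableSet_Ioo
          (fun t ht => (hd t ht).hasDerivWithinAt) hinj
          fun s => ENNReal.ofReal (bergmanNorm D (γ s) (derivWithin γ (Icc 0 1) s))).symm
    _ ≤ _ := lintegral_mono_set (hm.image_subset.trans Ioo_subset_Icc_self)

theorem bergmanDist_symm_le (x y : Cn n) : bergmanDist D x y ≤ bergmanDist D y x := by
  refine le_iInf₂ fun γ hγ => ?_
  have hmaps : MapsTo (fun t : ℝ => 1 - t) (Icc 0 1) (Icc 0 1) := fun t ht =>
    ⟨by linarith [ht.2], by linarith [ht.1]⟩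
  have hσ : IsCurveIn D x y fun t => γ (1 - t) :=
    { contDiffOn := hγ.contDiffOn.comp (by fun_prop) hmaps
      mapsTo := hγ.mapsTo.comp hmaps
      start_eq := by simp [hγ.end_eq]
      end_eq := by simp [hγ.start_eq] }
  refine (iInf₂_le _ hσ).trans ?_
  rw [bergmanLength, setLIntegral_congr Ioo_ae_eq_Icc.symm]
  refine lintegral_bergmanNorm_le_of_reparam hγ (h := fun t => 1 - t) (h' := fun _ => -1)
    subset_rfl (fun t _ => by simpa using (hasDerivAt_id t).const_sub 1)
    (fun s _ t _ hst => by simpa using hst)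
    (fun t ht => ⟨by linarith [ht.2], by linarith [ht.1]⟩) fun t _ => EventuallyEq.rfl

/-- Supplies the injectivity of the reparametrizations used to concatenate curves. -/
theorem strictMonoOn_smoothTransition : StrictMonoOn Real.smoothTransition (Ioo 0 1) := by
  intro s hs t ht hst
  have h1 : expNegInvGlue s < expNegInvGlue t := by
    rw [expNegInvGlue, expNegInvGlue, if_neg hs.1.not_ge, if_neg ht.1.not_ge, Real.exp_lt_exp,
      neg_lt_neg_iff]
    exact (inv_lt_inv₀ ht.1 hs.1).2 hst
  have h2 : expNegInvGlue (1 - t) ≤ expNegInvGlue (1 - s) :=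
    expNegInvGlue.monotone (by linarith)
  have h3 : 0 < expNegInvGlue (1 - t) := expNegInvGlue.pos_of_pos (by linarith [ht.2])
  have h4 : 0 < expNegInvGlue s := expNegInvGlue.pos_of_pos hs.1
  rw [Real.smoothTransition, Real.smoothTransition,
    div_lt_div_iff₀ (by linarith) (by linarith)]
  nlinarith

/-- Plain concatenation of $C^1$ curves may have a corner. Each curve is slowed down by
`Real.smoothTransition`, which is flat at both ends; this does not increase length. -/
theorem bergmanDist_triangle (x y z : Cn n) :
    bergmanDist D x z ≤ bergmanDist D x y + bergmanDist D y z := by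
  unfold bergmanDist
  simp only [iInf_subtype']
  refine ENNReal.le_iInf_add_iInf fun ⟨γ₁, h₁⟩ ⟨γ₂, h₂⟩ => ?_
  set S := Real.smoothTransition
  have hSmem : ∀ t, S t ∈ Icc (0 : ℝ) 1 := fun t =>
    ⟨Real.smoothTransition.nonneg t, Real.smoothTransition.le_one t⟩
  have hSdiff : ContDiff ℝ 1 S := Real.smoothTransition.contDiff (n := 1)
  have hS0 : ∀ t ≤ 0, S t = 0 := fun t => Real.smoothTransition.zero_of_nonpos
  have hS1 : ∀ t, 1 ≤ t → S t = 1 := fun t => Real.smoothTransition.one_of_one_le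
  -- On each half one of the two curves rests at `y` and cancels against `- y`. Written as a sum,
  -- `σ` is $C^1$ with no gluing at `1 / 2`, because `S` maps all of `ℝ` into `[0, 1]`.
  let σ : ℝ → Cn n := fun t => γ₁ (S (2 * t)) + (γ₂ (S (2 * t - 1)) - y)
  have hσ₁ : ∀ t ≤ 1 / 2, σ t = γ₁ (S (2 * t)) := fun t ht => by
    simp only [σ]
    rw [hS0 (2 * t - 1) (by linarith), h₂.start_eq, sub_self, add_zero]
  have hσ₂ : ∀ t, 1 / 2 ≤ t → σ t = γ₂ (S (2 * t - 1)) := fun t ht => by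
    simp only [σ]
    rw [hS1 (2 * t) (by linarith), h₁.end_eq, add_sub_cancel]
  have hσ : IsCurveIn D x z σ :=
    { contDiffOn := by
        refine ContDiff.contDiffOn ?_
        rw [← contDiffOn_univ]
        refine ContDiffOn.add ?_ (ContDiffOn.sub ?_ contDiffOn_const)
        · exact h₁.contDiffOn.comp (hSdiff.comp (by fun_prop)).contDiffOn fun t _ => hSmem _
        · exact h₂.contDiffOn.comp (hSdiff.comp (by fun_prop)).contDiffOn fun t _ => hSmem _
      mapsTo := fun t _ => by
        rcases le_total t (1 / 2) with ht | ht
        · rw [hσ₁ t ht]; exact h₁.mapsTo (hSmem _)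
        · rw [hσ₂ t ht]; exact h₂.mapsTo (hSmem _)
      start_eq := by rw [hσ₁ 0 (by norm_num), hS0 _ (by norm_num), h₁.start_eq]
      end_eq := by rw [hσ₂ 1 (by norm_num), hS1 _ (by norm_num), h₂.end_eq] }
  refine (iInf_le _ ⟨σ, hσ⟩).trans ?_
  have hSd : ∀ t, HasDerivAt S (deriv S t) t := fun t =>
    (hSdiff.differentiable one_ne_zero t).hasDerivAt
  have hSpos : ∀ t ∈ Ioo (0 : ℝ) 1, S t ∈ Ioo (0 : ℝ) 1 := fun t ht =>
    ⟨Real.smoothTransition.pos_of_pos ht.1, Real.smoothTransition.lt_one_of_lt_one ht.2⟩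
  have hdouble : ∀ t ∈ Ioo (0 : ℝ) (1 / 2), 2 * t ∈ Ioo (0 : ℝ) 1 := fun t ht =>
    ⟨by linarith [ht.1], by linarith [ht.2]⟩
  have hdouble' : ∀ t ∈ Ioo (1 / 2 : ℝ) 1, 2 * t - 1 ∈ Ioo (0 : ℝ) 1 := fun t ht =>
    ⟨by linarith [ht.1], by linarith [ht.2]⟩
  have hl₁ := lintegral_bergmanNorm_le_of_reparam h₁ (σ := σ) (a := 0) (b := 1 / 2)
    (h := fun t => S (2 * t)) (h' := fun t => deriv S (2 * t) * 2)
    (Ioo_subset_Ioo_right (by norm_num))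
    (fun t _ => HasDerivAt.comp (h := fun t => 2 * t) t (hSd (2 * t))
      (by simpa using (hasDerivAt_id t).const_mul (2 : ℝ)))
    (fun s hs t ht hst => by
      have := strictMonoOn_smoothTransition.injOn (hdouble s hs) (hdouble t ht) hst
      linarith)
    (fun t ht => hSpos _ (hdouble t ht))
    (fun t ht => by
      filter_upwards [Iio_mem_nhds ht.2] with s hs using hσ₁ s (le_of_lt hs))
  have hl₂ := lintegral_bergmanNorm_le_of_reparam h₂ (σ := σ) (a := 1 / 2) (b := 1)
    (h := fun t => S (2 * t - 1)) (h' := fun t => deriv S (2 * t - 1) * 2)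
    (Ioo_subset_Ioo_left (by norm_num))
    (fun t _ => HasDerivAt.comp (h := fun t => 2 * t - 1) t (hSd (2 * t - 1))
      (by simpa using ((hasDerivAt_id t).const_mul (2 : ℝ)).sub_const 1))
    (fun s hs t ht hst => by
      have := strictMonoOn_smoothTransition.injOn (hdouble' s hs) (hdouble' t ht) hst
      linarith)
    (fun t ht => hSpos _ (hdouble' t ht))
    (fun t ht => by
      filter_upwards [Ioi_mem_nhds ht.1] with s hs using hσ₂ s (le_of_lt hs))
  rw [setLIntegral_congr Ioo_ae_eq_Icc] at hl₁ hl₂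
  refine le_trans ?_ (add_le_add hl₁ hl₂)
  refine le_trans ?_ (lintegral_union_le _ _ _)
  exact lintegral_mono_set (Icc_subset_Icc_union_Icc)

theorem bergmanDist_self {x : Cn n} (hx : x ∈ D) : bergmanDist D x x = 0 := by
  refine le_antisymm ((iInf₂_le (fun _ => x) ⟨contDiffOn_const, fun _ _ => hx, rfl, rfl⟩).trans ?_)
    bot_le
  have h : ∀ z : Cn n, bergmanNorm D z 0 = 0 := fun z => by
    simpa using bergmanNorm_smul (D := D) z 0 0
  simp [bergmanLength, h]

theorem bergmanDist_le_of_ball {x y : Cn n} {r C : ℝ} (hr : Metric.ball x r ⊆ D)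
    (hnorm : ∀ z ∈ Metric.ball x r, ∀ v, bergmanNorm D z v ≤ C * ‖v‖)
    (hy : y ∈ Metric.ball x r) : bergmanDist D x y ≤ ENNReal.ofReal (C * ‖y - x‖) := by
  let γ : ℝ → Cn n := fun t => x + t • (y - x)
  have hball : MapsTo γ (Icc 0 1) (Metric.ball x r) := fun t ht => by
    rw [Metric.mem_ball, dist_eq_norm] at hy ⊢
    rw [add_sub_cancel_left, norm_smul, Real.norm_of_nonneg ht.1]
    nlinarith [norm_nonneg (y - x), ht.2, ht.1]
  have hγ : IsCurveIn D x y γ :=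
    { contDiffOn := by fun_prop
      mapsTo := hball.mono_right hr
      start_eq := by simp [γ]
      end_eq := by simp [γ] }
  refine (iInf₂_le _ hγ).trans ?_
  calc bergmanLength D γ ≤ ∫⁻ _ in Icc (0 : ℝ) 1, ENNReal.ofReal (C * ‖y - x‖) := by
        refine setLIntegral_mono' measurableSet_Icc fun t ht => ENNReal.ofReal_le_ofReal ?_
        have hd : HasDerivAt γ (y - x) t := by
          have h := ((hasDerivAt_id t).smul_const (y - x)).const_add x
          rwa [one_smul] at h
        rw [hd.hasDerivWithinAt.derivWithin (uniqueDiffOn_Icc_zero_one t ht)]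
        exact hnorm _ (hball ht) _
    _ = _ := by simp

theorem isCompleteMetricOn_bergmanDist (hD : IsHolomorphicHomogeneousRegular D) :
    IsCompleteMetricOn D (bergmanDist D) := by
  refine hD.isCompleteMetricOn _ (fun x hx => bergmanDist_self hx)
    (fun x _ y _ => bergmanDist_symm_le x y) (fun x _ y _ z _ => bergmanDist_triangle x y z)
    (fun x hx ε hε => ?_) (fun f hf hfm x _ y _ => ?_)
  · obtain ⟨r, hr, C, -, hrD, hnorm⟩ := exists_bergmanNorm_le hD.isOpen hD.isBounded hx
    have hlim : Tendsto (fun y : Cn n => ENNReal.ofReal (C * ‖y - x‖)) (𝓝 x) (𝓝 0) := by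
      have h : Continuous fun y : Cn n => ENNReal.ofReal (C * ‖y - x‖) :=
        ENNReal.continuous_ofReal.comp (by fun_prop)
      simpa using h.tendsto x
    filter_upwards [hlim.eventually (gt_mem_nhds hε), Metric.ball_mem_nhds x hr] with y hy hyr
    exact (bergmanDist_le_of_ball hrD hnorm hyr).trans_lt hy
  · obtain ⟨g, hg, hgxy⟩ := exists_dual_vector'' ℂ (f x - f y)
    have hφ : DifferentiableOn ℂ (fun z => g (f z)) D := g.differentiable.comp_differentiableOn hf
    have hφ1 : ∀ z ∈ D, ‖g (f z)‖ ≤ 1 := fun z hz =>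
      ((g.le_of_opNorm_le hg _).trans_eq (one_mul _)).trans (mem_ball_zero_iff.1 (hfm hz)).le
    have hnorm : ‖g (f x) - g (f y)‖ = ‖f x - f y‖ := by
      rw [← map_sub, hgxy]
      simp
    unfold bergmanDist
    simp only [iInf_subtype']
    rw [ENNReal.mul_iInf_of_ne (by simp) (by simp), ← hnorm]
    exact le_iInf fun γ => norm_sub_le_bergmanLength hD.isOpen hD.isBounded hφ hφ1 γ.2

end BergmanMetric

end HHR

end

theorem mainTheorem8 {n : ℕ} (D : Set (HHR.Cn n))
    (hD : HHR.IsHolomorphicHomogeneousRegular D) :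
    HHR.IsCompleteMetricOn D (HHR.kobayashiDist D) ∧
      HHR.IsCompleteMetricOn D (HHR.bergmanDist D) :=
  ⟨HHR.isCompleteMetricOn_kobayashiDist hD, HHR.isCompleteMetricOn_bergmanDist hD⟩
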